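/- An $i$-hedrite is a finite connected $4$-valent plane graph (multiple edges allowed) all of whose faces are $2$-, $3$- or $4$-gons and which has exactly $8-i$ faces that are $2$-gons. A graph is called $k$-connected if no set of fewer than $k$ vertices disconnects it. For an integer $m\ge 2$, take pairs of vertices $\{a_1,b_1\},\dots,\{a_m,b_m\}$, where each vertex of $\{a_k,b_k\}$ is joined by one edge to each vertex of $\{a_{k+1},b_{k+1}\}$ for $1\le k<m$, so that these $4$-cycles are nested in the plane; complete this to a $4$-valent plane graph by adding, at each of the two ends $k=1$ and $k=m$, either two parallel edges joining $a_k$ and $b_k$ and bounding a $2$-gon, or one new vertex joined to each of $a_k$ and $b_k$ by two parallel edges bounding a $2$-gon. - $I_{6,2m}$ is the graph with no new vertex; it is the $2m$-vertex $6$-hedrite such that each $2$-gon is adjacent to two $3$-gons. - $I_{5,2m+1}$ is the graph with exactly one new vertex; it is the $(2m+1)$-vertex $5$-hedrite such that two $2$-gons share a vertex (exactly one) and the remaining $2$-gon is adjacent to two $3$-gons. - $I_{4,2m+2}$ is the graph with two new vertices; it is the $(2m+2)$-vertex $4$-hedrite whose four $2$-gons are organized into two pairs, the two $2$-gons of each pair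 sharing a vertex (exactly one). - $J_{4,2m}$ is the $2m$-vertex $4$-hedrite formed by $m$ concentric circles and one more simple closed curve that crosses each of them in two points (the $m$-inflation of one central circuit of the $2$-vertex $4$-hedrite). **Theorem.** Every $i$-hedrite is $2$-connected. Every $i$-hedrite that is not $3$-connected is one of $I_{6,2m}$, $I_{5,2m+1}$, $I_{4,2m+2}$, $J_{4,2m}$ for some $m\ge 2$, or it is the $4$-cycle with all its edges doubled (the $4$-vertex $4$-hedrite with four $2$-gons and two opposite $4$-gons). Here plane graphs are identified up to orientation preserving homeomorphism of the sphere. -/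

import Mathlib

/-- A combinatorial map without isolated vertices, with set of darts (half-edges, or edges
together with a direction) `D`: `σ` takes a dart to the next dart around its tail in the
counterclockwise order, and `α` takes a dart to the opposite dart of the same edge.  Loops and
multiple edges are allowed.  Combinatorial maps on a finite set of darts encode the cellular
embeddings of finite (multi)graphs in closed oriented surfaces. -/
structure CombMap (D : Type*) where
  σ : Equiv.Perm D
  α : Equiv.Perm D
  α_α : ∀ d, α (α d) = d
  α_ne : ∀ d, α d ≠ d

namespace CombMap

variable {D : Type*}

/-- The permutation that walks along the boundaries of the faces. -/
def φ (M : CombMap D) : Equiv.Perm D := M.σ * M.α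

/-- Vertices are the cycles (fixed points included) of `σ`. -/
abbrev Vertex (M : CombMap D) : Type _ := Quotient (Equiv.Perm.SameCycle.setoid M.σ)

/-- Edges are the cycles of `α`. -/
abbrev Edge (M : CombMap D) : Type _ := Quotient (Equiv.Perm.SameCycle.setoid M.α)

/-- Faces are the cycles (fixed points included) of `φ`. -/
abbrev Face (M : CombMap D) : Type _ := Quotient (Equiv.Perm.SameCycle.setoid M.φ)

/-- The tail of a dart. -/
def vertexOf (M : CombMap D) (d : D) : M.Vertex := Quotient.mk _ d

/-- The face that has the dart on its boundary walk. -/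
def faceOf (M : CombMap D) (d : D) : M.Face := Quotient.mk _ d

/-- The degree (valency) of a vertex; a loop counts twice. -/
noncomputable def degree (M : CombMap D) (v : M.Vertex) : ℕ := Nat.card {d : D // M.vertexOf d = v}

/-- A face `f` is a `k`-gon if its boundary walk has length `k`, that is, if `M.size f = k`. -/
noncomputable def size (M : CombMap D) (f : M.Face) : ℕ := Nat.card {d : D // M.faceOf d = f}

/-- The number of vertices. -/
noncomputable def numVertices (M : CombMap D) : ℕ := Nat.card M.Vertex

/-- `M.p k` is the number of `k`-gonal faces. -/
noncomputable def p (M : CombMap D) (k : ℕ) : ℕ := Nat.card {f : M.Face // M.size f = k}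

/-- The underlying simple graph: two distinct vertices are adjacent if an edge joins them. -/
def graph (M : CombMap D) : SimpleGraph M.Vertex where
  Adj u v := u ≠ v ∧ ∃ d, M.vertexOf d = u ∧ M.vertexOf (M.α d) = v
  symm := ⟨by
    rintro u v ⟨huv, d, rfl, rfl⟩
    exact ⟨huv.symm, M.α d, rfl, by rw [M.α_α]⟩⟩
  loopless := ⟨fun _ h => h.1 rfl⟩

/-- `M` is a plane (that is, spherical) connected graph: it is connected and Euler's formula for
the sphere holds. -/
def IsPlane (M : CombMap D) : Prop :=
  M.graph.Connected ∧ Nat.card M.Vertex + Nat.card M.Face = Nat.card M.Edge + 2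

/-- `k`-connectedness: no set of fewer than `k` vertices disconnects the graph.  (As usual for
plane graphs with multiple edges, there is no lower bound on the number of vertices.) -/
def IsVertexConnected (M : CombMap D) (k : ℕ) : Prop :=
  ∀ S : Finset M.Vertex, S.card < k → (M.graph.induce ((S : Set M.Vertex)ᶜ)).Preconnected

/-- An `i`-hedrite: a connected `4`-valent plane graph all of whose faces are `2`-, `3`- or
`4`-gons, with exactly `8 - i` faces that are `2`-gons. -/
structure IsHedrite (M : CombMap D) (i : ℕ) : Prop where
  plane : M.IsPlane
  fourValent : ∀ v, M.degree v = 4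
  size_face : ∀ f, M.size f = 2 ∨ M.size f = 3 ∨ M.size f = 4
  p_two : M.p 2 + i = 8

/-- Isomorphism of combinatorial maps, i.e. equivalence of plane graphs under orientation
preserving homeomorphisms of the sphere. -/
def Iso {D' : Type*} (M : CombMap D) (N : CombMap D') : Prop :=
  ∃ e : D ≃ D', (∀ d, e (M.σ d) = N.σ (e d)) ∧ (∀ d, e (M.α d) = N.α (e d))

/-- Two faces are adjacent along an edge. -/
def FaceAdj (M : CombMap D) (f g : M.Face) : Prop := ∃ d, M.faceOf d = f ∧ M.faceOf (M.α d) = g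

/-- The vertex `v` lies on the face `f`. -/
def OnFace (M : CombMap D) (v : M.Vertex) (f : M.Face) : Prop :=
  ∃ d, M.vertexOf d = v ∧ M.faceOf d = f

/-- The face `f` is adjacent to two `3`-gons. -/
def AdjTwoTriangles (M : CombMap D) (f : M.Face) : Prop :=
  ∃ g h, g ≠ h ∧ M.size g = 3 ∧ M.size h = 3 ∧ M.FaceAdj f g ∧ M.FaceAdj f h

/-- The faces `f` and `g` share a vertex (and only one; in particular no edge). -/
def ShareVertex (M : CombMap D) (f g : M.Face) : Prop := ∃! v, M.OnFace v f ∧ M.OnFace v g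

end CombMap

/-- The darts of `chainMap m s n`. The dart `inner k b j` starts at the vertex `(k, b)` and points,
for `j = 0, 1, 2, 3`, to the north-east, north-west, south-west, south-east; `south` and `north` are
the darts at the poles, which are present if `s = true`, respectively `n = true`. -/
inductive ChainDart (m : ℕ) (s n : Bool) : Type
  | inner (k : Fin m) (b : Bool) (j : Fin 4)
  | south (hs : s = true) (hm : 0 < m) (b r : Bool)
  | north (hn : n = true) (hm : 0 < m) (b r : Bool)

namespace ChainDart

variable {m : ℕ} {s n : Bool}

/-- The rotation: `NE → NW → SW → SE → NE` at the vertices `(k, b)`; eastwards at the north pole and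
westwards at the south pole. -/
def rot : ChainDart m s n → ChainDart m s n
  | inner k b j => inner k b (j + 1)
  | south hs hm b true => south hs hm b false
  | south hs hm b false => south hs hm (!b) true
  | north hn hm b false => north hn hm b true
  | north hn hm b true => north hn hm (!b) false

/-- The inverse of `rot`. -/
def rotInv : ChainDart m s n → ChainDart m s n
  | inner k b j => inner k b (j - 1)
  | south hs hm b false => south hs hm b true
  | south hs hm b true => south hs hm (!b) false
  | north hn hm b true => north hn hm b false
  | north hn hm b false => north hn hm (!b) true

/-- The edges.  On each level `k < m` there are two vertices `(k, true)` and `(k, false)`, each of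
which is joined by one edge to each of the two vertices of the next level.  On the lowest level, the
two vertices are joined by two parallel edges (if `s = false`) or each of them is joined by two
parallel edges to the south pole (if `s = true`); in the same way for the highest level, `n` and the
north pole. -/
def flip : ChainDart m s n → ChainDart m s n
  | inner k b 0 =>
      if h : k.1 + 1 < m then inner ⟨k.1 + 1, h⟩ b 2
      else if hn : n = true then north hn (Nat.zero_lt_of_lt k.2) b true
      else inner k (!b) 1
  | inner k b 1 =>
      if h : k.1 + 1 < m then inner ⟨k.1 + 1, h⟩ (!b) 3
      else if hn : n = true then north hn (Nat.zero_lt_of_lt k.2) b false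
      else inner k (!b) 0
  | inner k b 2 =>
      if 0 < k.1 then inner ⟨k.1 - 1, lt_of_le_of_lt (Nat.sub_le _ _) k.2⟩ b 0
      else if hs : s = true then south hs (Nat.zero_lt_of_lt k.2) b false
      else inner k (!b) 3
  | inner k b 3 =>
      if 0 < k.1 then inner ⟨k.1 - 1, lt_of_le_of_lt (Nat.sub_le _ _) k.2⟩ (!b) 1
      else if hs : s = true then south hs (Nat.zero_lt_of_lt k.2) b true
      else inner k (!b) 2
  | south _ hm b false => inner ⟨0, hm⟩ b 2
  | south _ hm b true => inner ⟨0, hm⟩ b 3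
  | north _ hm b true => inner ⟨m - 1, Nat.sub_lt hm Nat.one_pos⟩ b 0
  | north _ hm b false => inner ⟨m - 1, Nat.sub_lt hm Nat.one_pos⟩ b 1

theorem rotInv_rot (d : ChainDart m s n) : rotInv (rot d) = d := by
  rcases d with ⟨k, b, j⟩ | ⟨hs, hm, b, r⟩ | ⟨hn, hm, b, r⟩
  · simp [rot, rotInv]
  · cases r <;> simp [rot, rotInv]
  · cases r <;> simp [rot, rotInv]

theorem rot_rotInv (d : ChainDart m s n) : rot (rotInv d) = d := by
  rcases d with ⟨k, b, j⟩ | ⟨hs, hm, b, r⟩ | ⟨hn, hm, b, r⟩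
  · simp [rot, rotInv]
  · cases r <;> simp [rot, rotInv]
  · cases r <;> simp [rot, rotInv]

theorem flip_flip (d : ChainDart m s n) : flip (flip d) = d := by
  rcases d with ⟨⟨k, hk⟩, b, j⟩ | ⟨hs, hm, b, r⟩ | ⟨hn, hm, b, r⟩
  · fin_cases j
    · by_cases h : k + 1 < m
      · simp [flip, h]
      · have : m - 1 = k := by omega
        by_cases hn : n = true <;> simp [flip, h, hn, this]
    · by_cases h : k + 1 < m
      · simp [flip, h]
      · have : m - 1 = k := by omega
        by_cases hn : n = true <;> simp [flip, h, hn, this]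
    · by_cases h : 0 < k
      · have h1 : k - 1 + 1 = k := by omega
        simp [flip, h, h1, hk]
      · obtain rfl : k = 0 := by omega
        by_cases hs : s = true <;> simp [flip, hs]
    · by_cases h : 0 < k
      · have h1 : k - 1 + 1 = k := by omega
        simp [flip, h, h1, hk]
      · obtain rfl : k = 0 := by omega
        by_cases hs : s = true <;> simp [flip, hs]
  · cases r <;> simp [flip, hs]
  · have h : ¬ (m - 1 + 1 < m) := by omega
    cases r <;> simp [flip, hn, h]

theorem flip_ne (d : ChainDart m s n) : flip d ≠ d := by
  rcases d with ⟨⟨k, hk⟩, b, j⟩ | ⟨hs, hm, b, r⟩ | ⟨hn, hm, b, r⟩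
  · fin_cases j <;> simp only [flip] <;> split_ifs <;> simp
  · cases r <;> simp [flip]
  · cases r <;> simp [flip]

end ChainDart

/-- `m` pairs of vertices, stacked along the axis of the sphere, consecutive pairs being joined by
`4`-cycles, with an extra vertex at the south pole if `s = true`, and at the north pole if
`n = true`. -/
def chainMap (m : ℕ) (s n : Bool) : CombMap (ChainDart m s n) where
  σ := ⟨ChainDart.rot, ChainDart.rotInv, ChainDart.rotInv_rot, ChainDart.rot_rotInv⟩
  α := Function.Involutive.toPerm ChainDart.flip ChainDart.flip_flip
  α_α := ChainDart.flip_flip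
  α_ne := ChainDart.flip_ne

/-- The edges of `inflationMap m`: the dart `(k, b, j)` starts at the vertex `(k, b)` and points, for
`j = 0, 1, 2, 3`, outwards, along the circle (counterclockwise), inwards, along the circle
(clockwise). -/
def inflationFlip (m : ℕ) : Fin m × Bool × Fin 4 → Fin m × Bool × Fin 4
  | (k, b, 0) => if h : k.1 + 1 < m then (⟨k.1 + 1, h⟩, b, 2) else (k, !b, 0)
  | (k, b, 1) => (k, !b, 3)
  | (k, b, 2) =>
      if 0 < k.1 then (⟨k.1 - 1, lt_of_le_of_lt (Nat.sub_le _ _) k.2⟩, b, 0) else (k, !b, 2)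
  | (k, b, 3) => (k, !b, 1)

theorem inflationFlip_inflationFlip {m : ℕ} (d : Fin m × Bool × Fin 4) :
    inflationFlip m (inflationFlip m d) = d := by
  obtain ⟨⟨k, hk⟩, b, j⟩ := d
  fin_cases j
  · by_cases h : k + 1 < m <;> simp [inflationFlip, h]
  · simp [inflationFlip]
  · by_cases h : 0 < k
    · have h1 : k - 1 + 1 = k := by omega
      simp [inflationFlip, h, h1, hk]
    · simp [inflationFlip, h]
  · simp [inflationFlip]

theorem inflationFlip_ne {m : ℕ} (d : Fin m × Bool × Fin 4) : inflationFlip m d ≠ d := by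
  obtain ⟨⟨k, hk⟩, b, j⟩ := d
  fin_cases j <;> simp only [inflationFlip] <;> (try split_ifs) <;> simp

/-- The `m`-inflation of one of the two central circuits of the `4`-hedrite with two vertices (two
simple closed curves that cross each other in two points): `m` concentric circles, each crossed in
the two points `(k, true)` and `(k, false)` by one further simple closed curve. -/
def inflationMap (m : ℕ) : CombMap (Fin m × Bool × Fin 4) where
  σ := (Equiv.refl (Fin m)).prodCongr ((Equiv.refl Bool).prodCongr (Equiv.addRight 1))
  α := Function.Involutive.toPerm (inflationFlip m) inflationFlip_inflationFlip
  α_α := inflationFlip_inflationFlip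
  α_ne := inflationFlip_ne

/-- The `4`-cycle with all its edges doubled, as a plane graph with four `2`-gons and two
`4`-gons. -/
def doubledFourCycle : CombMap (ChainDart 1 true true) := chainMap 1 true true

namespace CombMap

variable {D : Type*}

/-- `I_{6,2m}`: the `2m`-vertex `6`-hedrite such that each `2`-gon is adjacent to two `3`-gons. -/
structure IsI6 (G : CombMap D) (m : ℕ) : Prop where
  hedrite : G.IsHedrite 6
  numVertices_eq : G.numVertices = 2 * m
  twoGons : ∀ f, G.size f = 2 → G.AdjTwoTriangles f
  iso : G.Iso (chainMap m false false)

/-- `I_{5,2m+1}`: the `(2m+1)`-vertex `5`-hedrite such that two `2`-gons share a vertex and the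
remaining `2`-gon is adjacent to two `3`-gons. -/
structure IsI5 (G : CombMap D) (m : ℕ) : Prop where
  hedrite : G.IsHedrite 5
  numVertices_eq : G.numVertices = 2 * m + 1
  twoGons : ∃ f₁ f₂ f₃, (∀ f, G.size f = 2 ↔ f = f₁ ∨ f = f₂ ∨ f = f₃) ∧
    G.ShareVertex f₁ f₂ ∧ G.AdjTwoTriangles f₃
  iso : G.Iso (chainMap m true false)

/-- `I_{4,2m+2}`: the `(2m+2)`-vertex `4`-hedrite such that the four `2`-gons are organized into two
pairs sharing a vertex. -/
structure IsI4 (G : CombMap D) (m : ℕ) : Prop where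
  hedrite : G.IsHedrite 4
  numVertices_eq : G.numVertices = 2 * m + 2
  twoGons : ∃ f₁ f₂ g₁ g₂, (∀ f, G.size f = 2 ↔ f = f₁ ∨ f = f₂ ∨ f = g₁ ∨ f = g₂) ∧
    G.ShareVertex f₁ f₂ ∧ G.ShareVertex g₁ g₂
  iso : G.Iso (chainMap m true true)

/-- `J_{4,2m}`: the `m`-inflation of one central circuit of the `4`-hedrite with two vertices. -/
structure IsJ4 (G : CombMap D) (m : ℕ) : Prop where
  hedrite : G.IsHedrite 4
  numVertices_eq : G.numVertices = 2 * m
  iso : G.Iso (inflationMap m)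

end CombMap

/-! Everything local follows from one observation (`IsTame.corner`). Faces have at most four sides,
so a face that passes from a part `A` through a vertex into a part `B` with no edge to `A` is a
quadrangle, and its fourth corner lies outside `A` and `B`. If a single vertex `u` separates, that
fourth corner is again at `u`. For a minimal separated part, inspecting the four darts at `u` gives
a contradiction (`IsTame.noCutVertex`), hence 2-connectedness.

Planarity enters as the vanishing of the first cohomology of the sphere mod 2, which a rank count
extracts from Euler's formula (`IsPlane.exists_potential`). In other words, a closed curve
separates. Without cut vertices this forces each face to have at most one corner at each vertex
(`IsTame.eq_of_faceOf`, recorded in `IsRigid`), and it makes two edges with the same two faces an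
edge cut.

Let the vertices X, Y separate `A` from `B`, with `A` minimal. If X has only one edge to `A`,
pushing X across that edge gives a smaller part, so `A` is a single vertex, joined to Y by three
parallel edges. The outer two of these form a circle, and each circle forces the next one until an
edge closes the pattern: this is `J`.

Otherwise both X and Y have at least two edges to `A`. The corner observation and planarity then
force the heads around each of them to read `B B A A` (`Separates.exists_chainState`). This pattern
moves on to the next pair of vertices until a pole or a 2-gon ends the chain (`ChainState.step`). On
the side of `A`, minimality stops it at once.

A chain or a family of circles found in `G` defines an equivariant map from the model. It is
surjective because `G` is connected, and bijective because the vertices used along the way were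
counted (`bijective_of_hom`). Finally, the number of 2-gons determines `i`. -/

/-! ### Cycles of permutations and minimal periods. -/

theorem Equiv.Perm.natCard_sameCycle {D : Type*} (f : Equiv.Perm D) (d : D) :
    Nat.card {x // f.SameCycle x d} = Function.minimalPeriod f d := by
  have e : {x // f.SameCycle x d} ≃ MulAction.orbit (Subgroup.zpowers f) d := by
    refine Equiv.subtypeEquivRight fun x => ?_
    rw [Equiv.Perm.sameCycle_comm]
    constructor
    · rintro ⟨i, hi⟩
      exact ⟨⟨f ^ i, i, rfl⟩, hi⟩
    · rintro ⟨⟨_, i, rfl⟩, hi⟩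
      exact ⟨i, hi⟩
  -- An infinite cycle corresponds to `ZMod 0`; both sides are then `0`.
  rw [Nat.card_congr (e.trans (MulAction.orbitZPowersEquiv f d)), Nat.card_zmod]
  rfl

theorem Equiv.Perm.SameCycle.exists_iterate_lt {D : Type*} {f : Equiv.Perm D} {d x : D}
    (h : f.SameCycle d x) (hp : 0 < Function.minimalPeriod f d) :
    ∃ k < Function.minimalPeriod f d, f^[k] d = x := by
  obtain ⟨i, rfl⟩ := h
  have h0 : (0 : ℤ) < Function.minimalPeriod f d := by exact_mod_cast hp
  obtain ⟨k, hk⟩ := Int.eq_ofNat_of_zero_le (Int.emod_nonneg i h0.ne')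
  refine ⟨k, ?_, ?_⟩
  · have := Int.emod_lt_of_pos i h0
    omega
  · have hper : (f ^ (Function.minimalPeriod f d : ℤ)) d = d := by
      rw [zpow_natCast]
      have := Function.iterate_minimalPeriod (f := f) (x := d)
      rwa [← Equiv.Perm.coe_pow] at this
    rw [← Equiv.Perm.coe_pow, ← zpow_natCast, show (k : ℤ) = _ from hk.symm]
    conv_rhs => rw [← Int.emod_add_mul_ediv i (Function.minimalPeriod f d), zpow_add, zpow_mul]
    rw [Equiv.Perm.mul_apply, Equiv.Perm.zpow_apply_eq_self_of_apply_eq_self hper]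

/-! ### Darts, degrees and face lengths. -/

namespace CombMap

variable {D : Type*} {G : CombMap D}

theorem vertexOf_eq_iff {d d' : D} : G.vertexOf d = G.vertexOf d' ↔ G.σ.SameCycle d d' :=
  Quotient.eq

theorem faceOf_eq_iff {d d' : D} : G.faceOf d = G.faceOf d' ↔ G.φ.SameCycle d d' :=
  Quotient.eq

@[simp] theorem vertexOf_σ (d : D) : G.vertexOf (G.σ d) = G.vertexOf d :=
  vertexOf_eq_iff.2 (Equiv.Perm.sameCycle_apply_left.2 (Equiv.Perm.SameCycle.refl _ _))

theorem φ_apply (d : D) : G.φ d = G.σ (G.α d) := rfl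

@[simp] theorem faceOf_φ (d : D) : G.faceOf (G.φ d) = G.faceOf d :=
  faceOf_eq_iff.2 (Equiv.Perm.sameCycle_apply_left.2 (Equiv.Perm.SameCycle.refl _ _))

@[simp] theorem faceOf_σ_α (d : D) : G.faceOf (G.σ (G.α d)) = G.faceOf d := faceOf_φ d

theorem degree_vertexOf (d : D) : G.degree (G.vertexOf d) = Function.minimalPeriod G.σ d := by
  rw [← Equiv.Perm.natCard_sameCycle]
  exact Nat.card_congr (Equiv.subtypeEquivRight fun x => vertexOf_eq_iff)

theorem size_faceOf (d : D) : G.size (G.faceOf d) = Function.minimalPeriod G.φ d := by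
  rw [← Equiv.Perm.natCard_sameCycle]
  exact Nat.card_congr (Equiv.subtypeEquivRight fun x => faceOf_eq_iff)

theorem exists_vertexOf_eq (v : G.Vertex) : ∃ d, G.vertexOf d = v := Quotient.exists_rep v

theorem exists_faceOf_eq (f : G.Face) : ∃ d, G.faceOf d = f := Quotient.exists_rep f

/-- In a connected map, a set of darts that is invariant under both permutations is everything. -/
theorem forall_of_connected (hG : G.graph.Connected) {P : D → Prop} (hσ : ∀ d, P d → P (G.σ d))
    (hσ' : ∀ d, P (G.σ d) → P d) (hα : ∀ d, P d → P (G.α d)) {d₀ : D} (h₀ : P d₀) (d : D) :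
    P d := by
  have hiff : ∀ d d', G.vertexOf d = G.vertexOf d' → (P d → P d') := by
    intro d d' h hd
    obtain ⟨i, rfl⟩ := vertexOf_eq_iff.1 h
    induction i using Int.induction_on with
    | zero => simpa using hd
    | succ i ih =>
      have := hσ _ (ih (vertexOf_eq_iff.2 ⟨i, rfl⟩))
      rwa [← Equiv.Perm.mul_apply, mul_self_zpow] at this
    | pred i ih =>
      refine hσ' _ ?_
      have := ih (vertexOf_eq_iff.2 ⟨-i, rfl⟩)
      rwa [← Equiv.Perm.mul_apply, mul_self_zpow, sub_add_cancel]
  have key : ∀ v, G.graph.Reachable (G.vertexOf d₀) v → ∀ d, G.vertexOf d = v → P d := by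
    rintro v ⟨w⟩
    revert w
    suffices ∀ u v, G.graph.Walk u v → (∀ d, G.vertexOf d = u → P d) →
        ∀ d, G.vertexOf d = v → P d from
      fun w => this _ _ w fun d hd => hiff _ _ hd.symm h₀
    intro u v w
    induction w with
    | nil => exact id
    | cons hadj _ ih =>
      intro h
      refine ih fun d hd => ?_
      obtain ⟨-, e, he, he'⟩ := hadj
      exact hiff _ _ (he'.trans hd.symm) (hα _ (h _ he))
  exact key _ (hG.preconnected _ _) d rfl

/-- The local structure of a map in which all vertices have degree `4` and all faces have between
two and four sides. -/
structure IsTame (G : CombMap D) : Prop where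
  σ_four : ∀ d, G.σ (G.σ (G.σ (G.σ d))) = d
  σ_ne : ∀ d, G.σ d ≠ d
  σ_σ_ne : ∀ d, G.σ (G.σ d) ≠ d
  eq_of_vertexOf : ∀ d d', G.vertexOf d = G.vertexOf d' →
    d' = d ∨ d' = G.σ d ∨ d' = G.σ (G.σ d) ∨ d' = G.σ (G.σ (G.σ d))
  face_ne : ∀ d, G.σ (G.α d) ≠ d
  face : ∀ d, G.σ (G.α (G.σ (G.α d))) = d ∨ G.σ (G.α (G.σ (G.α (G.σ (G.α d))))) = d ∨
    G.σ (G.α (G.σ (G.α (G.σ (G.α (G.σ (G.α d))))))) = d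

/-- Degrees and face sizes are minimal periods of `σ` and `φ`. The resulting equations between darts
are what the local arguments use. -/
theorem IsHedrite.isTame {i : ℕ} (hG : G.IsHedrite i) : G.IsTame := by
  have hσ : ∀ d, Function.minimalPeriod G.σ d = 4 := fun d =>
    (degree_vertexOf d).symm.trans (hG.fourValent _)
  have hφ : ∀ d, Function.minimalPeriod G.φ d = 2 ∨ Function.minimalPeriod G.φ d = 3 ∨
      Function.minimalPeriod G.φ d = 4 := fun d => by
    simpa only [size_faceOf] using hG.size_face (G.faceOf d)
  refine ⟨fun d => ?_, fun d h => ?_, fun d h => ?_, fun d d' h => ?_, fun d h => ?_, fun d => ?_⟩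
  · have := Function.iterate_minimalPeriod (f := G.σ) (x := d)
    rwa [hσ] at this
  · have := Function.IsPeriodicPt.minimalPeriod_le (n := 1) one_pos
      (show Function.IsPeriodicPt G.σ 1 d from h)
    rw [hσ] at this
    omega
  · have := Function.IsPeriodicPt.minimalPeriod_le (n := 2) two_pos
      (show Function.IsPeriodicPt G.σ 2 d from h)
    rw [hσ] at this
    omega
  · obtain ⟨k, hk, rfl⟩ := (vertexOf_eq_iff.1 h).exists_iterate_lt (by rw [hσ]; norm_num)
    rw [hσ] at hk
    interval_cases k <;> simp
  · have := Function.IsPeriodicPt.minimalPeriod_le (n := 1) one_pos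
      (show Function.IsPeriodicPt G.φ 1 d from h)
    have := hφ d
    omega
  · have := Function.iterate_minimalPeriod (f := G.φ) (x := d)
    rcases hφ d with h | h | h <;> rw [h] at this
    · exact Or.inl this
    · exact Or.inr (Or.inl this)
    · exact Or.inr (Or.inr this)

/-! ### First cohomology of the sphere mod 2. -/

/-- The kernel lies in the line of constants. This is applied to the coboundaries of functions on
vertices and on faces, where connectedness supplies the hypothesis. -/
theorem finrank_ker_le_one {K X W : Type*} [Field K] [AddCommGroup W] [Module K W]
    (L : (X → K) →ₗ[K] W) (h : ∀ g, L g = 0 → ∀ x y, g x = g y) :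
    Module.finrank K (LinearMap.ker L) ≤ 1 := by
  rcases isEmpty_or_nonempty X with hX | ⟨⟨x₀⟩⟩
  · rw [Module.finrank_zero_of_subsingleton]
    exact zero_le_one
  · refine (Submodule.finrank_mono (t := K ∙ (1 : X → K)) fun g hg => ?_).trans
      (finrank_span_le_card _ |>.trans (by simp))
    rw [Submodule.mem_span_singleton]
    exact ⟨g x₀, funext fun x => by simp [h g hg x x₀]⟩

theorem sameCycle_α_iff {d d' : D} : G.α.SameCycle d d' ↔ d' = d ∨ d' = G.α d := by
  constructor
  · rintro ⟨i, rfl⟩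
    have h2 : G.α * G.α = 1 := Equiv.ext G.α_α
    obtain ⟨k, rfl | rfl⟩ := Int.even_or_odd' i
    · left; rw [zpow_mul, zpow_two, h2, one_zpow]; rfl
    · right; rw [zpow_add, zpow_mul, zpow_two, h2, one_zpow, zpow_one]; rfl
  · rintro (rfl | rfl)
    · exact Equiv.Perm.SameCycle.refl _ _
    · exact Equiv.Perm.sameCycle_apply_right.2 (Equiv.Perm.SameCycle.refl _ _)

/-- The edge of a dart. -/
def edgeOf (G : CombMap D) (d : D) : G.Edge := Quotient.mk _ d

theorem edgeOf_eq_iff {d d' : D} : G.edgeOf d = G.edgeOf d' ↔ d' = d ∨ d' = G.α d :=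
  Quotient.eq.trans sameCycle_α_iff

@[simp] theorem edgeOf_α (d : D) : G.edgeOf (G.α d) = G.edgeOf d :=
  edgeOf_eq_iff.2 (Or.inr (G.α_α d).symm)

theorem out_eq_or (e : G.Edge) (d : D) (h : G.edgeOf d = e) : e.out = d ∨ e.out = G.α d := by
  refine edgeOf_eq_iff.1 (h.trans ?_)
  exact (Quotient.out_eq e).symm

open Classical in
/-- The sphere has trivial first cohomology: a `ZMod 2`-valued function on the edges that sums to
zero around each face is the coboundary of a function on the vertices. -/
theorem IsPlane.exists_potential [Fintype D] (hG : G.IsPlane) (ω : D → ZMod 2)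
    (hα : ∀ d, ω (G.α d) = ω d) (hface : ∀ f, ∑ d with G.faceOf d = f, ω d = 0) :
    ∃ g : G.Vertex → ZMod 2, ∀ d, ω d = g (G.vertexOf d) + g (G.vertexOf (G.α d)) := by
  obtain ⟨hc, hE⟩ := hG
  have char2 : ∀ a b : ZMod 2, a + b = 0 → a = b := by decide
  have self2 : ∀ a : ZMod 2, a + a = 0 := by decide
  -- Modulo 2 the coboundary does not depend on the dart `e.out` chosen for the edge.
  let δ : (G.Vertex → ZMod 2) →ₗ[ZMod 2] (G.Edge → ZMod 2) :=
    { toFun := fun g e => g (G.vertexOf e.out) + g (G.vertexOf (G.α e.out))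
      map_add' := fun g h => by ext e; simp only [Pi.add_apply]; ring
      map_smul' := fun c g => by ext e; simp only [Pi.smul_apply, smul_eq_mul, RingHom.id_apply]; ring }
  have δ_apply : ∀ g d, δ g (G.edgeOf d) = g (G.vertexOf d) + g (G.vertexOf (G.α d)) := by
    intro g d
    change g (G.vertexOf (G.edgeOf d).out) + g (G.vertexOf (G.α (G.edgeOf d).out)) = _
    rcases out_eq_or (G.edgeOf d) d rfl with h | h <;> rw [h]
    rw [G.α_α, add_comm]
  have hnonempty : Nonempty D := by
    obtain ⟨v⟩ := hc.nonempty
    obtain ⟨d, -⟩ := exists_vertexOf_eq v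
    exact ⟨d⟩
  obtain ⟨d₀⟩ := hnonempty
  -- Incidence of edges and faces mod 2, an edge with the same face on both sides counting twice.
  -- The transpose sums a function on edges around each face.
  let B : Matrix G.Edge G.Face (ZMod 2) := fun e f =>
    (if G.faceOf e.out = f then 1 else 0) + (if G.faceOf (G.α e.out) = f then 1 else 0)
  have B_apply : ∀ h d, B.mulVecLin h (G.edgeOf d) = h (G.faceOf d) + h (G.faceOf (G.α d)) := by
    intro h d
    have : B.mulVecLin h (G.edgeOf d) = h (G.faceOf (G.edgeOf d).out) +
        h (G.faceOf (G.α (G.edgeOf d).out)) := by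
      rw [Matrix.mulVecLin_apply, Matrix.mulVec, dotProduct]
      simp [B, add_mul, Finset.sum_add_distrib]
    rw [this]
    rcases out_eq_or (G.edgeOf d) d rfl with h | h <;> rw [h]
    rw [G.α_α, add_comm]
  have Bt_apply : ∀ w f, B.transpose.mulVecLin w f = ∑ d with G.faceOf d = f, w (G.edgeOf d) := by
    intro w f
    rw [← Finset.sum_fiberwise (Finset.univ.filter fun d => G.faceOf d = f) G.edgeOf]
    simp only [Matrix.mulVecLin_apply, Matrix.mulVec, dotProduct, Matrix.transpose_apply]
    refine Finset.sum_congr rfl fun e _ => ?_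
    have hfib : (Finset.univ.filter fun d => G.edgeOf d = e) = {e.out, G.α e.out} := by
      ext d
      have : G.edgeOf e.out = e := Quotient.out_eq e
      simp only [Finset.mem_filter, Finset.mem_univ, true_and, Finset.mem_insert,
        Finset.mem_singleton]
      rw [← edgeOf_eq_iff, this, eq_comm]
    rw [Finset.filter_filter]
    have : ∀ d, (G.faceOf d = f ∧ G.edgeOf d = e) ↔ (G.edgeOf d = e ∧ G.faceOf d = f) :=
      fun d => and_comm
    simp only [this]
    rw [← Finset.filter_filter, hfib, Finset.sum_filter, Finset.sum_pair (G.α_ne _).symm]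
    have : G.edgeOf e.out = e := Quotient.out_eq e
    simp [B, add_mul, this]
  have hδ : Module.finrank (ZMod 2) (LinearMap.ker δ) ≤ 1 := by
    refine finrank_ker_le_one δ fun g hg x y => ?_
    have key : ∀ d, g (G.vertexOf d) = g (G.vertexOf d₀) :=
      forall_of_connected hc (fun d h => by simpa using h) (fun d h => by simpa using h)
        (fun d h => by
          rw [← h]; refine (char2 _ _ ?_).symm; rw [← δ_apply, hg]; rfl) rfl
    obtain ⟨d, rfl⟩ := exists_vertexOf_eq x
    obtain ⟨d', rfl⟩ := exists_vertexOf_eq y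
    rw [key d, key d']
  have hB : Module.finrank (ZMod 2) (LinearMap.ker B.mulVecLin) ≤ 1 := by
    refine finrank_ker_le_one _ fun h hh x y => ?_
    have h1 : ∀ d, h (G.faceOf d) = h (G.faceOf (G.α d)) := fun d => by
      refine char2 _ _ ?_; rw [← B_apply, hh]; rfl
    have h2 : ∀ d, h (G.faceOf (G.σ d)) = h (G.faceOf d) := fun d => by
      have := faceOf_σ_α (G := G) (G.α d)
      rw [G.α_α] at this
      rw [this, h1 d]
    have key : ∀ d, h (G.faceOf d) = h (G.faceOf d₀) :=
      forall_of_connected hc (fun d h => by rw [h2, h]) (fun d h => by rw [← h2, h])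
        (fun d h => by rw [← h1, h]) rfl
    obtain ⟨d, rfl⟩ := exists_faceOf_eq x
    obtain ⟨d', rfl⟩ := exists_faceOf_eq y
    rw [key d, key d']
  -- Along a face walk each vertex occurs equally often as a tail and as a head.
  have hle : LinearMap.range δ ≤ LinearMap.ker B.transpose.mulVecLin := by
    rintro _ ⟨g, rfl⟩
    ext f
    rw [Bt_apply]
    simp only [δ_apply, Finset.sum_add_distrib, Pi.zero_apply]
    have : ∑ d with G.faceOf d = f, g (G.vertexOf (G.α d)) =
        ∑ d with G.faceOf d = f, g (G.vertexOf d) := by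
      refine Finset.sum_equiv G.φ (fun d => by simp) fun d _ => ?_
      rw [φ_apply, vertexOf_σ]
    rw [this, self2]
  have heq : LinearMap.range δ = LinearMap.ker B.transpose.mulVecLin := by
    -- The range of `δ` has dimension at least `V - 1`, the kernel of the transpose at most `E - (F
    -- - 1)`. By Euler's formula these bounds agree.
    refine Submodule.eq_of_le_of_finrank_le hle ?_
    have e1 := δ.finrank_range_add_finrank_ker
    have e2 := B.mulVecLin.finrank_range_add_finrank_ker
    have e3 := B.transpose.mulVecLin.finrank_range_add_finrank_ker
    have e4 := B.rank_transpose
    simp only [Matrix.rank] at e4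
    simp only [Module.finrank_fintype_fun_eq_card, ← Nat.card_eq_fintype_card] at e1 e2 e3
    omega
  have hω : (fun e : G.Edge => ω e.out) ∈ LinearMap.range δ := by
    rw [heq]
    ext f
    rw [Bt_apply, Pi.zero_apply, ← hface f]
    refine Finset.sum_congr rfl fun d _ => ?_
    rcases out_eq_or (G.edgeOf d) d rfl with h | h <;> rw [h]
    rw [hα]
  obtain ⟨g, hg⟩ := hω
  refine ⟨g, fun d => ?_⟩
  rw [← δ_apply, hg]
  change ω d = ω (G.edgeOf d).out
  rcases out_eq_or (G.edgeOf d) d rfl with h | h <;> rw [h]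
  rw [hα]

/-! ### Corners of faces between separated parts; absence of cut vertices. -/

/-- If `A` and `B` are sets of vertices without edges between them, a face that goes from `A`
through one vertex to `B` is a quadrangle. -/
theorem IsTame.corner (hG : G.IsTame) {A B : Set G.Vertex} (hd : Disjoint A B)
    (hAB : ∀ d, G.vertexOf d ∈ A → G.vertexOf (G.α d) ∉ B) {e : D}
    (hA : G.vertexOf (G.α e) ∈ A) (hB : G.vertexOf (G.α (G.σ e)) ∈ B) :
    ∃ w, w = G.σ (G.α (G.σ (G.α (G.σ e)))) ∧ G.σ (G.α w) = G.α e ∧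
      G.vertexOf w ∉ A ∧ G.vertexOf w ∉ B ∧ G.vertexOf (G.α w) ∈ A ∧
      G.vertexOf (G.α (G.σ (G.σ (G.σ w)))) ∈ B := by
  have h1 := hG.face (G.α e)
  have h4 := hG.σ_four
  have ha := G.α_α
  have hv := G.vertexOf_σ
  have hd' := Set.disjoint_left.1 hd
  refine ⟨_, rfl, ?_⟩
  grind

/-- There is no cut vertex. -/
def NoCutVertex (G : CombMap D) : Prop :=
  ∀ (u : G.Vertex) (A : Set G.Vertex), A.Nonempty → u ∉ A →
    (∀ d, G.vertexOf d ∈ A → G.vertexOf (G.α d) ∈ A ∨ G.vertexOf (G.α d) = u) →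
    ∀ w, w ≠ u → w ∈ A

theorem exists_dart_of_exits (hG : G.graph.Connected) {u : G.Vertex} {A : Set G.Vertex}
    (hA : A.Nonempty) (hu : u ∉ A)
    (hexit : ∀ d, G.vertexOf d ∈ A → G.vertexOf (G.α d) ∈ A ∨ G.vertexOf (G.α d) = u) :
    ∃ d, G.vertexOf d = u ∧ G.vertexOf (G.α d) ∈ A := by
  by_contra! hcon
  obtain ⟨v, hv⟩ := hA
  obtain ⟨d, rfl⟩ := exists_vertexOf_eq v
  obtain ⟨d', rfl⟩ := exists_vertexOf_eq u
  refine hu (forall_of_connected hG (P := fun d => G.vertexOf d ∈ A) (fun d h => by simpa using h)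
    (fun d h => by simpa using h) (fun d h => (hexit d h).resolve_right fun h' => ?_) hv d')
  exact hcon _ h' (by rwa [G.α_α])

/-- Take a minimal part `A` cut off by one vertex `u` and read off, around `u`, which heads lie in
`A` and which in the rest `B`. Every corner between `A` and `B` belongs to a quadrangle that returns
to `u`. -/
theorem IsTame.noCutVertex [Finite D] (hG : G.IsTame) (hc : G.graph.Connected) :
    G.NoCutVertex := by
  by_contra hcon
  let P : Set G.Vertex → Prop := fun A => A.Nonempty ∧ ∃ u w, u ∉ A ∧ w ∉ A ∧ w ≠ u ∧
    ∀ d, G.vertexOf d ∈ A → G.vertexOf (G.α d) ∈ A ∨ G.vertexOf (G.α d) = u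
  have hex : ∃ A, P A := by
    simp only [NoCutVertex] at hcon
    push Not at hcon
    obtain ⟨u, A, h1, h2, h3, w, h4, h5⟩ := hcon
    exact ⟨A, h1, u, w, h2, h5, h4, h3⟩
  obtain ⟨A, ⟨hA, u, w, hu, hw, hwu, hexit⟩, hmin⟩ := exists_minimal_of_wellFoundedLT P hex
  have h4 := hG.σ_four
  have ha := G.α_α
  have hv := G.vertexOf_σ
  have hne := hG.σ_ne
  have hne2 := hG.σ_σ_ne
  have hat := hG.eq_of_vertexOf
  have hane := G.α_ne
  have hf := hG.face_ne
  -- `A` has no smaller part that is separated by one of its vertices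
  have hsmall : ∀ v ∈ A, (∀ d, G.vertexOf d = u → G.vertexOf (G.α d) ∈ A →
      G.vertexOf (G.α d) = v) → ∀ x ∈ A, x = v := by
    intro v hvA h x hx
    by_contra hxv
    have : P (A \ {v}) := by
      refine ⟨⟨x, hx, hxv⟩, v, u, by simp, fun h => hu h.1, fun h => hu (h ▸ hvA), ?_⟩
      rintro d ⟨hd, hdv⟩
      rcases hexit d hd with h1 | h1
      · by_cases h2 : G.vertexOf (G.α d) = v
        · exact Or.inr h2
        · exact Or.inl ⟨h1, h2⟩
      · exact (hdv (by have := h _ h1 (by rwa [ha]); rwa [ha] at this)).elim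
    exact (hmin this Set.sdiff_subset hvA).2 rfl
  let B : Set G.Vertex := {x | x ∉ A ∧ x ≠ u}
  have hdisj : Disjoint A B := Set.disjoint_left.2 fun x h1 h2 => h2.1 h1
  have hAB : ∀ d, G.vertexOf d ∈ A → G.vertexOf (G.α d) ∉ B := fun d h1 h2 =>
    (hexit d h1).elim h2.1 h2.2
  have hBA : ∀ d, G.vertexOf d ∈ B → G.vertexOf (G.α d) ∉ A := fun d h1 h2 =>
    hAB _ h2 (by rwa [ha])
  have htri : ∀ x, x ∈ A ∨ x ∈ B ∨ x = u := fun x => by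
    by_cases h1 : x ∈ A
    · exact Or.inl h1
    · by_cases h2 : x = u
      · exact Or.inr (Or.inr h2)
      · exact Or.inr (Or.inl ⟨h1, h2⟩)
  have huB : u ∉ B := fun h => h.2 rfl
  obtain ⟨e, he, heA⟩ := exists_dart_of_exits hc hA hu hexit
  obtain ⟨b, hb, hbB⟩ := exists_dart_of_exits hc (A := B) ⟨w, hw, hwu⟩ huB fun d hd =>
    (htri (G.vertexOf (G.α d))).elim (fun h => (hBA d hd h).elim) id
  have hdj := Set.disjoint_left.1 hdisj
  clear_value B
  -- a second dart from `u` to `A`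
  obtain ⟨e', he', heA', hee'⟩ : ∃ e', G.vertexOf e' = u ∧ G.vertexOf (G.α e') ∈ A ∧ e' ≠ e := by
    -- With only one such dart, minimality makes `A` a single vertex, and the fixed-point-free
    -- involution `α` would have to pair its other three darts.
    by_contra! hcon
    have hone := hsmall _ heA fun d hd hdA => by rw [hcon d hd hdA]
    have key : ∀ d, G.vertexOf d = G.vertexOf (G.α e) → d ≠ G.α e →
        G.vertexOf (G.α d) = G.vertexOf (G.α e) := by
      intro d hd hde
      rcases hexit d (hd ▸ heA) with h | h
      · exact hone _ h
      · exact absurd (hcon _ h (by rw [ha, hd]; exact heA)) (by grind)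
    have k1 := key (G.σ (G.α e)) (by simp) (hne _)
    have k2 := key (G.σ (G.σ (G.α e))) (by simp) (hne2 _)
    have k3 := key (G.σ (G.σ (G.σ (G.α e)))) (by simp) (by grind)
    have q1 := hat _ _ k1.symm
    have q2 := hat _ _ k2.symm
    have q3 := hat _ _ k3.symm
    grind
  -- Besides `e`, `e'` and `b` only one dart at `u` is left, too few for a loop. So all heads lie in
  -- `A` or `B`, and somewhere a dart to `A` is followed by one to `B`.
  obtain ⟨c, hcu, hcA, hcB⟩ : ∃ c, G.vertexOf c = u ∧ G.vertexOf (G.α c) ∈ A ∧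
      G.vertexOf (G.α (G.σ c)) ∈ B := by
    have t3 := htri (G.vertexOf (G.α (G.σ (G.σ (G.σ b)))))
    have l1 : ∀ d, G.vertexOf d = u → G.vertexOf (G.α d) = u → G.α d = b ∨ G.α d = G.σ b ∨
        G.α d = G.σ (G.σ b) ∨ G.α d = G.σ (G.σ (G.σ b)) := fun d h1 h2 =>
      hat b (G.α d) (hb.trans h2.symm)
    have l4 := l1 (G.σ (G.σ (G.σ b)))
    by_contra! hcon
    grind
  obtain ⟨w, -, hw2, hw3a, hw3, hw4, hw5⟩ := hG.corner hdisj hAB hcA hcB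
  have hwu : G.vertexOf w = u := by
    rcases htri (G.vertexOf w) with h | h | h
    exacts [(hw3a h).elim, (hw3 h).elim, h]
  rcases hat c w (hcu.trans hwu.symm) with rfl | rfl | h | h
  · exact hne _ hw2
  · exact hdj hw4 hcB
  -- The heads alternate `A B A B`. The first and third corners give `σ (α (σ (σ c))) = α c` and `σ
  -- (α c) = α (σ (σ c))`, so `σ ∘ σ` would fix `α c`.
  · have hBAc : G.vertexOf (G.α (G.σ (G.σ c))) ∈ A := h ▸ hw4
    obtain ⟨w₂, -, p1, p2, p3, p4, p5⟩ := hG.corner hdisj.symm hBA hcB hBAc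
    have hw₂ : w₂ = G.σ (G.σ (G.σ c)) := by
      have := htri (G.vertexOf w₂)
      have := hat c w₂
      grind
    obtain ⟨w₃, -, r1, r2, r3, r4, r5⟩ := hG.corner hdisj hAB hBAc (hw₂ ▸ p4)
    have hw₃ : w₃ = c := by
      have := htri (G.vertexOf w₃)
      have := hat c w₃
      grind
    grind
  -- The heads read `A B B A`, and both darts to `A` have the same head, so `A` is one vertex. Its
  -- remaining two consecutive darts would form a loop bounding a 1-gon.
  · have hB2 : G.vertexOf (G.α (G.σ (G.σ c))) ∈ B := by
      rw [h, h4] at hw5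
      grind
    have hd : ∀ d, G.vertexOf d = u → G.vertexOf (G.α d) ∈ A → d = c ∨ d = w := by
      intro d h1 h2
      have := hat c d (hcu.trans h1.symm)
      grind
    have hone := hsmall (G.vertexOf (G.α c)) hcA fun d h1 h2 => by
      rcases hd d h1 h2 with rfl | rfl
      · rfl
      · rw [← hw2, hv]
    clear hsmall hmin
    have key : ∀ d, G.vertexOf d = G.vertexOf (G.α c) → d ≠ G.α c → d ≠ G.α w →
        G.vertexOf (G.α d) = G.vertexOf (G.α w) := by
      intro d h1 h2 h3
      rcases hexit d (h1 ▸ hcA) with h | h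
      · have := hone _ h
        grind
      · have := hd _ h (by rw [ha, h1]; exact hcA)
        grind
    have k1 := key (G.σ (G.σ (G.α w))) (by rw [← hw2]; simp)
      (fun h => hne _ (h.trans hw2.symm)) (hne2 _)
    rcases hat (G.α w) (G.α (G.σ (G.σ (G.α w)))) k1.symm with h | h | h | h
    · have h' := G.α.injective h
      rw [← h', hv, hv] at hw3a
      exact hw3a hw4
    · have h' := G.α.injective (h.trans hw2)
      rw [← h', hv, hv] at hcu
      exact hu (hcu ▸ hw4)
    · exact hane _ h
    · refine hf (G.σ (G.σ (G.σ (G.α w)))) ?_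
      rw [← h, ha, h]

/-! ### Closed curves through faces, and faces with repeated corners. -/

-- Read `h` as a curve crossing each dart with `h d = 1` near its tail. Its arcs end in the corners
-- where `h` changes between `σ⁻¹ d` and `d`. The hypothesis says that every face contains an even
-- number of such ends, so the arcs can be closed up inside the faces. The edge of `d` is crossed `h
-- d + h (α d)` times.
open Classical in
theorem IsPlane.exists_potential_of_darts [Fintype D] (hG : G.IsPlane) (h : D → ZMod 2)
    (hface : ∀ f, ∑ d with G.faceOf d = f, (h d + h (G.σ.symm d)) = 0) :
    ∃ g : G.Vertex → ZMod 2, ∀ d, h d + h (G.α d) = g (G.vertexOf d) + g (G.vertexOf (G.α d)) := by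
  refine hG.exists_potential (fun d => h d + h (G.α d)) (fun d => ?_) fun f => ?_
  · rw [G.α_α, add_comm]
  · rw [← hface f, Finset.sum_add_distrib, Finset.sum_add_distrib]
    congr 1
    refine Finset.sum_equiv G.φ (fun d => by simp) fun d _ => ?_
    rw [φ_apply, Equiv.symm_apply_apply]

open Classical in
theorem sum_face_single [Fintype D] (f : G.Face) (d : D) :
    ∑ x with G.faceOf x = f, (Pi.single d 1 : D → ZMod 2) x = if G.faceOf d = f then 1 else 0 := by
  rw [Finset.sum_filter, Finset.sum_eq_single d]
  · simp
  · intro b _ hb; simp [hb]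
  · simp

open Classical in
theorem sum_face_single_symm [Fintype D] (f : G.Face) (d : D) :
    ∑ x with G.faceOf x = f, (Pi.single d 1 : D → ZMod 2) (G.σ.symm x) =
      if G.faceOf (G.σ d) = f then 1 else 0 := by
  rw [← sum_face_single]
  refine Finset.sum_congr rfl fun x _ => ?_
  simp only [Pi.single_apply, Equiv.symm_apply_eq]

-- The curve cuts an arc of darts at `u` off from the others. The vertices with `g` different from
-- `g u` can be left only through `u`, and the head of `x₀` is one of them. The dart `x₁` is not
-- crossed at its tail: its head shows that `u` is a cut vertex, or, if it is a loop, its number of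
-- crossings has the wrong parity.
open Classical in
theorem NoCutVertex.false_of_arc [Fintype D] (hc : G.NoCutVertex) (hG : G.IsPlane) (h : D → ZMod 2)
    (hface : ∀ f, ∑ d with G.faceOf d = f, (h d + h (G.σ.symm d)) = 0) (u : G.Vertex)
    (hu : ∀ x, h x ≠ 0 → G.vertexOf x = u) {x₀ : D} (h₀ : G.vertexOf x₀ = u)
    (h₀' : h x₀ ≠ h (G.α x₀)) {x₁ : D} (h₁ : G.vertexOf x₁ = u) (h₁' : h x₁ = 0)
    (h₁'' : G.vertexOf (G.α x₁) = u → h (G.α x₁) ≠ 0) : False := by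
  have char2 : ∀ a b : ZMod 2, a + b = 0 ↔ a = b := by decide
  obtain ⟨g, hg⟩ := hG.exists_potential_of_darts h hface
  have hout : ∀ x, G.vertexOf x ≠ u → h x = 0 := fun x hx => by
    by_contra hne
    exact hx (hu x hne)
  have key := hc u {w | g w ≠ g u} ⟨G.vertexOf (G.α x₀), fun heq => h₀' ?_⟩ (by simp) ?_
  · by_cases hx : G.vertexOf (G.α x₁) = u
    · refine h₁'' hx ?_
      have := hg x₁
      rwa [h₁', zero_add, h₁, hx, (char2 _ _).2 rfl] at this
    · refine key _ hx ?_
      have := hg x₁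
      rw [h₁', hout _ hx, add_zero, h₁, eq_comm, char2] at this
      exact this.symm
  · rw [← char2, hg, char2, h₀]
    exact heq.symm
  · intro d hd
    by_cases hx : G.vertexOf (G.α d) = u
    · exact Or.inr hx
    · refine Or.inl fun heq => hd ?_
      have h1 : G.vertexOf d ≠ u := fun h => hd (h ▸ rfl)
      have := hg d
      rw [hout _ h1, hout _ hx, add_zero, eq_comm, char2] at this
      exact this.trans heq

/-- In a plane map without cut vertices, a face has at most one corner at a vertex. -/
theorem IsTame.eq_of_faceOf [Finite D] (hG : G.IsTame) (hc : G.NoCutVertex) (hp : G.IsPlane)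
    {d d' : D} (hv : G.vertexOf d = G.vertexOf d') (hf : G.faceOf d = G.faceOf d') : d = d' := by
  classical
  have := Fintype.ofFinite D
  have h4 := hG.σ_four
  have ha := G.α_α
  have hne := hG.σ_ne
  have hne2 := hG.σ_σ_ne
  have hane := G.α_ne
  have hfn := hG.face_ne
  have hat := hG.eq_of_vertexOf
  have self2 : ∀ a : ZMod 2, a + a = 0 := by decide
  have h1 : ∀ d, G.faceOf d ≠ G.faceOf (G.σ d) := by
    intro d hf
    -- Otherwise `α` would pair the three darts at this vertex other than `d` among themselves.
    obtain ⟨x₁, h₁, h₁', h₁''⟩ : ∃ x₁, G.vertexOf x₁ = G.vertexOf d ∧ x₁ ≠ d ∧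
        (G.vertexOf (G.α x₁) = G.vertexOf d → G.α x₁ = d) := by
      by_contra! hcon
      have q1 := hcon (G.σ d) (by simp) (hne _)
      have q2 := hcon (G.σ (G.σ d)) (by simp) (hne2 _)
      have q3 := hcon (G.σ (G.σ (G.σ d))) (by simp) fun h => hne d (by
        simpa only [h4, eq_comm] using congrArg G.σ h)
      have p2 := hat _ _ q2.1.symm
      clear hat hcon
      grind
    refine hc.false_of_arc hp (Pi.single d 1) (fun f => ?_) (G.vertexOf d) (x₀ := d) (x₁ := x₁)
      ?_ rfl ?_ h₁ ?_ ?_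
    · rw [Finset.sum_add_distrib, sum_face_single, sum_face_single_symm, hf, self2]
    · intro x hx
      by_contra hxd
      exact hx (Pi.single_eq_of_ne (fun h : x = d => hxd (congrArg _ h)) _)
    · rw [Pi.single_eq_same, Pi.single_eq_of_ne (hane d)]
      exact one_ne_zero
    · exact Pi.single_eq_of_ne h₁' _
    · intro h
      rw [h₁'' h, Pi.single_eq_same]
      exact one_ne_zero
  have h2 : ∀ d, G.faceOf d ≠ G.faceOf (G.σ (G.σ d)) := by
    intro d hf
    -- The arc between the corners of `d` and `σ (σ d)` consists of `d` and `σ d`.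
    refine hc.false_of_arc hp (Pi.single d 1 + Pi.single (G.σ d) 1) (fun f => ?_) (G.vertexOf d)
      (x₀ := d) (x₁ := G.σ (G.σ d)) ?_ rfl ?_ (by simp) ?_ ?_
    · simp only [Pi.add_apply, Finset.sum_add_distrib]
      rw [sum_face_single, sum_face_single_symm, sum_face_single, sum_face_single_symm, hf]
      generalize (if G.faceOf (G.σ (G.σ d)) = f then (1 : ZMod 2) else 0) = a
      generalize (if G.faceOf (G.σ d) = f then (1 : ZMod 2) else 0) = b
      revert a b
      decide
    · intro x hx
      by_contra hxd
      refine hx ?_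
      rw [Pi.add_apply, Pi.single_eq_of_ne (fun h : x = d => hxd (congrArg _ h)),
        Pi.single_eq_of_ne (fun h : x = G.σ d => hxd (by rw [h]; simp)), add_zero]
    · rw [Pi.add_apply, Pi.add_apply, Pi.single_eq_same, Pi.single_eq_of_ne (hne d).symm,
        Pi.single_eq_of_ne (hane d), Pi.single_eq_of_ne, add_zero, add_zero]
      · exact one_ne_zero
      · intro h
        exact hfn (G.σ d) (by rw [← h, ha, h])
    · rw [Pi.add_apply, Pi.single_eq_of_ne (hne2 d), Pi.single_eq_of_ne (hne _), add_zero]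
    · intro h
      have := hat _ _ h.symm
      have h3 := hfn (G.σ (G.σ (G.σ d)))
      rcases this with h' | h' | h' | h'
      · rw [h', Pi.add_apply, Pi.single_eq_same, Pi.single_eq_of_ne (hne d).symm, add_zero]
        exact one_ne_zero
      · rw [h', Pi.add_apply, Pi.single_eq_same, Pi.single_eq_of_ne (hne d), zero_add]
        exact one_ne_zero
      · exact (hane _ h').elim
      · exact (h3 (by rw [← h', ha, h'])).elim
  rcases hat d d' hv with rfl | rfl | rfl | rfl
  · rfl
  · exact (h1 _ hf).elim
  · exact (h2 _ hf).elim
  · refine (h1 (G.σ (G.σ (G.σ d))) ?_).elim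
    rw [h4, hf]

/-- Two edges that lie on the same two faces form an edge cut. -/
theorem IsPlane.exists_potential_of_two_edges [Finite D] (hp : G.IsPlane) {d d' : D}
    (h : G.faceOf d = G.faceOf d') (h' : G.faceOf (G.α d) = G.faceOf (G.α d')) (hdd : d ≠ d')
    (hdd' : d ≠ G.α d') :
    ∃ g : G.Vertex → ZMod 2, g (G.vertexOf d) ≠ g (G.vertexOf (G.α d)) ∧
      ∀ x, x ≠ d → x ≠ G.α d → x ≠ d' → x ≠ G.α d' →
        g (G.vertexOf x) = g (G.vertexOf (G.α x)) := by
  classical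
  have := Fintype.ofFinite D
  have ha := G.α_α
  have char2 : ∀ a b : ZMod 2, a + b = 0 ↔ a = b := by decide
  have hσ : ∀ x, G.faceOf (G.σ x) = G.faceOf (G.α x) := fun x => by
    have := faceOf_σ_α (G := G) (G.α x)
    rwa [ha] at this
  obtain ⟨g, hg⟩ := hp.exists_potential_of_darts (Pi.single d 1 + Pi.single d' 1) fun f => by
    simp only [Pi.add_apply, Finset.sum_add_distrib]
    rw [sum_face_single, sum_face_single_symm, sum_face_single, sum_face_single_symm, hσ, hσ, h,
      h']
    generalize (if G.faceOf d' = f then (1 : ZMod 2) else 0) = a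
    generalize (if G.faceOf (G.α d') = f then (1 : ZMod 2) else 0) = b
    revert a b
    decide
  refine ⟨g, fun heq => ?_, fun x h1 h2 h3 h4 => ?_⟩
  · have := hg d
    rw [(char2 _ _).2 heq, Pi.add_apply, Pi.add_apply, Pi.single_eq_same, Pi.single_eq_of_ne hdd,
      Pi.single_eq_of_ne (G.α_ne d), Pi.single_eq_of_ne, add_zero, add_zero] at this
    · exact one_ne_zero this
    · intro h
      exact hdd' (by rw [← h, ha])
  · rw [← char2, ← hg, Pi.add_apply, Pi.add_apply, Pi.single_eq_of_ne h1, Pi.single_eq_of_ne h3,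
      Pi.single_eq_of_ne, Pi.single_eq_of_ne]
    · simp only [add_zero]
    · intro h; exact h4 (by rw [← h, ha])
    · intro h; exact h2 (by rw [← h, ha])

/-- A connected tame map without cut vertices in which each face has at most one corner at each
vertex. -/
structure IsRigid (G : CombMap D) : Prop extends G.IsTame where
  connected : G.graph.Connected
  noCutVertex : G.NoCutVertex
  eq_of_faceOf : ∀ d d', G.vertexOf d = G.vertexOf d' → G.faceOf d = G.faceOf d' → d = d'

theorem IsHedrite.isRigid [Finite D] {i : ℕ} (hG : G.IsHedrite i) : G.IsRigid where
  toIsTame := hG.isTame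
  connected := hG.plane.1
  noCutVertex := hG.isTame.noCutVertex hG.plane.1
  eq_of_faceOf _ _ := hG.isTame.eq_of_faceOf (hG.isTame.noCutVertex hG.plane.1) hG.plane

/-- For a loop `d`, the dart `σ (α d)` has the same vertex and the same face as `d`, so it equals
`d` and bounds a 1-gon. -/
theorem IsRigid.no_loop (hG : G.IsRigid) (d : D) : G.vertexOf (G.α d) ≠ G.vertexOf d := fun h =>
  hG.face_ne d (hG.eq_of_faceOf _ _ (by simpa using h) (by simp))

/-! ### Separating pairs of vertices and the propagation of chains. -/

/-- The dart that leaves the head of `d` opposite to `d`. -/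
def straight (G : CombMap D) (d : D) : D := G.σ (G.σ (G.α d))

/-- Removing the tails of `x` and `y` leaves the parts `A` and `B` without edges between them. -/
structure Separates (G : CombMap D) (x y : D) (A B : Set G.Vertex) : Prop where
  ne : G.vertexOf x ≠ G.vertexOf y
  cover : ∀ w, w ∈ A ∨ w ∈ B ∨ w = G.vertexOf x ∨ w = G.vertexOf y
  disj : Disjoint A B
  left_notMem_left : G.vertexOf x ∉ A
  left_notMem_right : G.vertexOf x ∉ B
  right_notMem_left : G.vertexOf y ∉ A
  right_notMem_right : G.vertexOf y ∉ B
  edge : ∀ d, G.vertexOf d ∈ A → G.vertexOf (G.α d) ∉ B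

theorem Separates.edge' {x y : D} {A B : Set G.Vertex} (h : G.Separates x y A B) (d : D)
    (hd : G.vertexOf d ∈ B) : G.vertexOf (G.α d) ∉ A := fun h' =>
  h.edge _ h' (by rwa [G.α_α])

theorem Separates.symm {x y : D} {A B : Set G.Vertex} (h : G.Separates x y A B) :
    G.Separates x y B A where
  ne := h.ne
  cover w := by have := h.cover w; tauto
  disj := h.disj.symm
  left_notMem_left := h.left_notMem_right
  left_notMem_right := h.left_notMem_left
  right_notMem_left := h.right_notMem_right
  right_notMem_right := h.right_notMem_left
  edge := h.edge'

theorem Separates.swap {x y : D} {A B : Set G.Vertex} (h : G.Separates x y A B) :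
    G.Separates y x A B where
  ne := h.ne.symm
  cover w := by have := h.cover w; tauto
  disj := h.disj
  left_notMem_left := h.right_notMem_left
  left_notMem_right := h.right_notMem_right
  right_notMem_left := h.left_notMem_left
  right_notMem_right := h.left_notMem_right
  edge := h.edge

theorem Separates.congr {x y x' y' : D} {A B : Set G.Vertex} (h : G.Separates x y A B)
    (hx : G.vertexOf x' = G.vertexOf x) (hy : G.vertexOf y' = G.vertexOf y) :
    G.Separates x' y' A B := by
  obtain ⟨h1, h2, h3, h4, h5, h6, h7, h8⟩ := h
  constructor <;> simpa only [hx, hy]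

/-- If a face goes from `A` through the tail of `x` to `B`, it is a quadrangle that returns through
the tail of `y`. -/
theorem Separates.corner {x y e : D} {A B : Set G.Vertex} (h : G.Separates x y A B)
    (hG : G.IsRigid) (he : G.vertexOf e = G.vertexOf x) (hA : G.vertexOf (G.α e) ∈ A)
    (hB : G.vertexOf (G.α (G.σ e)) ∈ B) :
    ∃ w, w = G.σ (G.α (G.σ (G.α (G.σ e)))) ∧ G.σ (G.α w) = G.α e ∧
      G.vertexOf w = G.vertexOf y ∧ G.vertexOf (G.α w) ∈ A ∧
      G.vertexOf (G.α (G.σ (G.σ (G.σ w)))) ∈ B := by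
  obtain ⟨w, hw, h1, h2, h3, h4, h5⟩ := hG.toIsTame.corner h.disj h.edge hA hB
  refine ⟨w, hw, h1, ?_, h4, h5⟩
  rcases h.cover (G.vertexOf w) with h' | h' | h' | h'
  · exact (h2 h').elim
  · exact (h3 h').elim
  -- A return to the tail of `x` would, by rigidity, be the corner of `σ e`, whose head lies in `B`
  -- and not in `A`.
  · have : w = G.σ e := hG.eq_of_faceOf _ _ (by rw [h', vertexOf_σ, he]) (by rw [hw]; simp)
    rw [this] at h4
    exact (Set.disjoint_left.1 h.disj h4 hB).elim
  · exact h'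

/-- The tails of `x` and `y` separate `A` from `B`, and both of them have two consecutive edges to
`B` and two consecutive edges to `A`. -/
structure ChainState (G : CombMap D) (x y : D) (A B : Set G.Vertex) : Prop
    extends G.Separates x y A B where
  x0 : G.vertexOf (G.α x) ∈ B
  x1 : G.vertexOf (G.α (G.σ x)) ∈ B
  x2 : G.vertexOf (G.α (G.σ (G.σ x))) ∈ A
  x3 : G.vertexOf (G.α (G.σ (G.σ (G.σ x)))) ∈ A
  y0 : G.vertexOf (G.α y) ∈ B
  y1 : G.vertexOf (G.α (G.σ y)) ∈ B
  y2 : G.vertexOf (G.α (G.σ (G.σ y))) ∈ A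
  y3 : G.vertexOf (G.α (G.σ (G.σ (G.σ y)))) ∈ A

theorem ChainState.swap {x y : D} {A B : Set G.Vertex} (h : G.ChainState x y A B) :
    G.ChainState y x A B :=
  ⟨h.toSeparates.swap, h.y0, h.y1, h.y2, h.y3, h.x0, h.x1, h.x2, h.x3⟩

theorem ChainState.turn {x y : D} {A B : Set G.Vertex} (h : G.ChainState x y A B)
    (hG : G.IsTame) : G.ChainState (G.σ (G.σ x)) (G.σ (G.σ y)) B A :=
  ⟨h.toSeparates.symm.congr (by simp) (by simp), h.x2, h.x3, by rw [hG.σ_four]; exact h.x0,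
    by rw [hG.σ_four]; exact h.x1, h.y2, h.y3, by rw [hG.σ_four]; exact h.y0,
    by rw [hG.σ_four]; exact h.y1⟩

/-- The face between `σ (σ (σ x))`, which leads to `A`, and `x`, which leads to `B`, returns through
the tail of `y`. The pattern there leaves only the corner of `σ (σ y)`. -/
theorem ChainState.quad {x y : D} {A B : Set G.Vertex} (h : G.ChainState x y A B)
    (hG : G.IsRigid) : G.σ (G.α x) = G.α (G.σ y) := by
  obtain ⟨w, hw, h1, h2, h3, h4⟩ := h.toSeparates.corner hG (e := G.σ (G.σ (G.σ x))) (by simp) h.x3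
    (by rw [hG.σ_four]; exact h.x0)
  rw [hG.σ_four] at hw
  have hdj := Set.disjoint_left.1 h.disj
  rcases hG.eq_of_vertexOf _ _ h2.symm with h' | h' | h' | h'
  · rw [h'] at h3; exact (hdj h3 h.y0).elim
  · rw [h'] at h3; exact (hdj h3 h.y1).elim
  · rw [h'] at hw
    rw [G.σ.injective hw, G.α_α]
  · rw [h', hG.σ_four] at h4
    exact (hdj h.y2 h4).elim

/-- The edges at the tails of `x` and `y` bound a pole. -/
def IsPole (G : CombMap D) (x y : D) : Prop :=
  G.σ (G.α x) = G.α (G.σ y) ∧ G.σ (G.α y) = G.α (G.σ x) ∧ G.α y = G.σ (G.σ (G.α x))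

/-- The tails of `x` and `y` are joined by two parallel edges. -/
def IsDigon (G : CombMap D) (x y : D) : Prop :=
  G.α x = G.σ y ∧ G.α y = G.σ x

/-- The `4`-cycle between the tails of `x` and `y` and the next two vertices. -/
def IsLink (G : CombMap D) (x y : D) : Prop :=
  G.σ (G.α x) = G.α (G.σ y) ∧ G.σ (G.α y) = G.α (G.σ x)

/-- By `ChainState.quad` the edges to `B` end at two common heads, possibly equal. If the heads
agree, they are a pole. If not, the two faces beyond are both triangles, and the next pair closes
with a 2-gon, or both quadrangles, and the pattern repeats at the next pair. -/
theorem ChainState.step {x y : D} {A B : Set G.Vertex} (h : G.ChainState x y A B)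
    (hG : G.IsRigid) :
    G.IsPole x y ∨ G.IsLink x y ∧ G.vertexOf (G.α x) ≠ G.vertexOf (G.α y) ∧
      (G.IsDigon (G.straight x) (G.straight y) ∨
        G.ChainState (G.straight x) (G.straight y) (A ∪ {G.vertexOf x, G.vertexOf y})
          (B \ {G.vertexOf (G.α x), G.vertexOf (G.α y)})) := by
  have h4 := hG.σ_four
  have ha := G.α_α
  have hv := G.vertexOf_σ
  have hne2 := hG.σ_σ_ne
  have hat := hG.eq_of_vertexOf
  have hx := h.quad hG
  have hy := h.swap.quad hG
  have hdj := Set.disjoint_left.1 h.disj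
  have hxy : x ≠ y := fun h' => h.ne (by rw [h'])
  by_cases hb : G.vertexOf (G.α x) = G.vertexOf (G.α y)
  · left
    refine ⟨hx, hy, ?_⟩
    have := hat _ _ hb
    clear hat hdj
    grind
  · right
    refine ⟨⟨hx, hy⟩, hb, ?_⟩
    -- The face through `α x` and `σ x` continues with `straight y`. It closes there, as a triangle,
    -- or after one more dart, as a quadrangle with a new fourth vertex.
    have key : ∀ x y, G.σ (G.α x) = G.α (G.σ y) → G.σ (G.α y) = G.α (G.σ x) →
        G.vertexOf (G.α x) ≠ G.vertexOf (G.α y) →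
        G.α (G.straight y) = G.σ (G.straight x) ∨
        G.σ (G.α (G.straight y)) = G.α (G.σ (G.straight x)) ∧
        G.vertexOf (G.α (G.straight y)) ≠ G.vertexOf (G.α x) ∧
        G.vertexOf (G.α (G.straight y)) ≠ G.vertexOf (G.α y) := by
      intro x y hx hy hb
      have f1 := hG.face (G.α x)
      have f2 := hG.eq_of_faceOf (G.σ (G.α (G.straight y))) (G.α x)
      have f3 := hG.no_loop (G.straight y)
      have e1 : G.faceOf (G.σ (G.α (G.straight y))) = G.faceOf (G.α x) := by
        rw [faceOf_σ_α, straight, hy, ← faceOf_σ_α (G.α x), ha, ← faceOf_σ_α (G.σ x)]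
      simp only [straight] at *
      clear hat hdj
      grind
    have k1 := key x y hx hy hb
    have k2 := key y x hy hx (Ne.symm hb)
    -- A triangle on one side and a quadrangle on the other would put two corners of one face at the
    -- head of `X`.
    have mixed : ∀ X Y, G.α Y = G.σ X → G.σ (G.α X) = G.α (G.σ Y) → False := by
      intro X Y h1 h2
      refine hne2 (G.α X) (hG.eq_of_faceOf _ _ (by simp) ?_)
      rw [h2, faceOf_σ_α, ← faceOf_σ_α (G.α X), ha, ← faceOf_σ_α (G.σ X), ← h1, ha]
    have mem : ∀ x y, G.ChainState x y A B → G.σ (G.α x) = G.α (G.σ y) →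
        G.σ (G.α y) = G.α (G.σ x) → G.vertexOf (G.α x) ≠ G.vertexOf (G.α y) →
        G.vertexOf (G.α (G.straight x)) ∈ B := by
      intro x y h hx hy hb
      have c1 := h.cover (G.vertexOf (G.α (G.straight x)))
      have c2 := h.edge' (G.straight x) (by simpa [straight] using h.x0)
      rcases c1 with c | c | c | c
      · exact (c2 c).elim
      · exact c
      · obtain ⟨-, x0, x1, x2, x3, y0, y1, y2, y3⟩ := h
        have := hat _ _ c.symm
        simp only [straight] at *
        clear hat c c2 h4 k1 k2 mixed
        exfalso
        rcases this with h | h | h | h <;> grind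
      · obtain ⟨-, x0, x1, x2, x3, y0, y1, y2, y3⟩ := h
        have := hat _ _ c.symm
        simp only [straight] at *
        clear hat c c2 h4 k1 k2 mixed
        exfalso
        rcases this with h | h | h | h <;> grind
    have mx := mem x y h hx hy hb
    have my := mem y x h.swap hy hx (Ne.symm hb)
    have tx : G.vertexOf (G.straight x) = G.vertexOf (G.α x) := by simp [straight]
    have ty : G.vertexOf (G.straight y) = G.vertexOf (G.α y) := by simp [straight]
    rcases k1 with k1 | ⟨k1, k1', k1''⟩ <;> rcases k2 with k2 | ⟨k2, k2', k2''⟩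
    · exact Or.inl ⟨k2, k1⟩
    · exact (mixed _ _ k1 k2).elim
    · exact (mixed _ _ k2 k1).elim
    · right
      refine ⟨⟨?_, ?_, ?_, ?_, ?_, ?_, ?_, ?_⟩, ?_, ?_, ?_, ?_, ?_, ?_, ?_, ?_⟩
      · rwa [tx, ty]
      · intro w
        have := h.cover w
        simp only [tx, ty, Set.mem_union, Set.mem_sdiff, Set.mem_insert_iff,
          Set.mem_singleton_iff]
        tauto
      · refine Set.disjoint_left.2 fun w hw hw' => ?_
        rcases hw with hw | rfl | rfl
        · exact hdj hw hw'.1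
        · exact h.left_notMem_right hw'.1
        · exact h.right_notMem_right hw'.1
      · rw [tx]
        rintro (hw | hw | hw)
        · exact hdj hw h.x0
        · exact h.left_notMem_right (hw ▸ h.x0)
        · exact h.right_notMem_right ((show G.vertexOf (G.α x) = G.vertexOf y from hw) ▸ h.x0)
      · rw [tx]; exact fun hw => hw.2 (Or.inl rfl)
      · rw [ty]
        rintro (hw | hw | hw)
        · exact hdj hw h.y0
        · exact h.left_notMem_right (hw ▸ h.y0)
        · exact h.right_notMem_right ((show G.vertexOf (G.α y) = G.vertexOf y from hw) ▸ h.y0)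
      · rw [ty]; exact fun hw => hw.2 (Or.inr rfl)
      · rintro d (hd | hd | hd) ⟨hd1, hd2⟩
        · exact h.edge d hd hd1
        · rcases hat _ _ hd.symm with rfl | rfl | rfl | rfl
          · exact hd2 (Or.inl rfl)
          · exact hd2 (Or.inr (by rw [← hy]; simp))
          · exact hdj h.x2 hd1
          · exact hdj h.x3 hd1
        · rcases hat _ _ (show G.vertexOf d = G.vertexOf y from hd).symm with rfl | rfl | rfl | rfl
          · exact hd2 (Or.inr rfl)
          · exact hd2 (Or.inl (by rw [← hx]; simp))
          · exact hdj h.y2 hd1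
          · exact hdj h.y3 hd1
      · exact ⟨mx, by simp [k2', k2'']⟩
      · rw [← k1, hv]
        exact ⟨my, by simp [k1', k1'']⟩
      · rw [straight, h4, ha]
        exact Or.inr (Or.inl rfl)
      · rw [straight, h4, hx, ha]
        exact Or.inr (Or.inr (hv y))
      · exact ⟨my, by simp [k1', k1'']⟩
      · rw [← k2, hv]
        exact ⟨mx, by simp [k2', k2'']⟩
      · rw [straight, h4, ha]
        exact Or.inr (Or.inr rfl)
      · rw [straight, h4, hy, ha]
        exact Or.inr (Or.inl (hv x))

/-- The end of a chain of pairs of vertices: a pole or a `2`-gon. -/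
def IsCap (G : CombMap D) (n : Bool) (x y : D) : Prop :=
  (n = true → G.IsPole x y) ∧ (n = false → G.IsDigon x y)

/-- Each link uses up two vertices of `B` and a pole one more. This count later replaces a proof
that the vertices of the chain are distinct. -/
theorem ChainState.exists_cap [Finite D] (hG : G.IsRigid) {x y : D} {A B : Set G.Vertex}
    (h : G.ChainState x y A B) :
    ∃ m n, (∀ k < m, G.IsLink (G.straight^[k] x) (G.straight^[k] y)) ∧
      G.IsCap n (G.straight^[m] x) (G.straight^[m] y) ∧ 2 * m + n.toNat ≤ B.ncard := by
  induction hN : B.ncard using Nat.strong_induction_on generalizing x y A B with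
  | _ N ih =>
  have hpos : 0 < B.ncard := (Set.ncard_pos).2 ⟨_, h.x0⟩
  rcases h.step hG with hp | ⟨hl, hb, hd | hs⟩
  · exact ⟨0, true, by simp, ⟨fun _ => hp, by simp⟩, by simp; omega⟩
  all_goals
    have h2 : ({G.vertexOf (G.α x), G.vertexOf (G.α y)} : Set G.Vertex) ⊆ B := by
      rintro w (rfl | rfl)
      exacts [h.x0, h.y0]
    have h3 := Set.ncard_pair hb
    have h4 := Set.ncard_le_ncard h2
  · refine ⟨1, false, ?_, ⟨by simp, fun _ => hd⟩, by simp; omega⟩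
    intro k hk
    obtain rfl : k = 0 := by omega
    exact hl
  · have h5 := Set.ncard_sdiff h2
    obtain ⟨m, n, h6, h7, h8⟩ := ih _ (by omega) hs rfl
    refine ⟨m + 1, n, ?_, h7, by omega⟩
    rintro (_ | k) hk
    · exact hl
    · exact h6 k (by omega)

/-- The darts `x` and `y` point upwards from the lowest level of a chain of `m + 1` pairs of
vertices with ends given by `s` and `n`. -/
structure IsChain (G : CombMap D) (m : ℕ) (s n : Bool) (x y : D) : Prop where
  link : ∀ k < m, G.IsLink (G.straight^[k] x) (G.straight^[k] y)
  top : G.IsCap n (G.straight^[m] x) (G.straight^[m] y)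
  bot : G.IsCap s (G.σ (G.σ x)) (G.σ (G.σ y))

/-! ### Equivariant maps from the chain models. -/

/-- Equivariant maps to a connected map from a map with at most as many darts are bijective. -/
theorem bijective_of_hom {E : Type*} [Finite E] [Nonempty E] {N : CombMap E}
    (hc : G.graph.Connected) (f : E → D) (hσ : ∀ d, f (N.σ d) = G.σ (f d))
    (hα : ∀ d, f (N.α d) = G.α (f d)) (hcard : Nat.card E ≤ Nat.card D) :
    Function.Bijective f := by
  refine Function.Surjective.bijective_of_nat_card_le ?_ hcard
  intro d
  obtain ⟨e₀⟩ := ‹Nonempty E›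
  refine forall_of_connected hc (P := fun d => ∃ e, f e = d) ?_ ?_ ?_ ⟨e₀, rfl⟩ d
  · rintro _ ⟨e, rfl⟩
    exact ⟨_, hσ e⟩
  · rintro d ⟨e, he⟩
    refine ⟨N.σ.symm e, G.σ.injective ?_⟩
    rw [← hσ, Equiv.apply_symm_apply, he]
  · rintro _ ⟨e, rfl⟩
    exact ⟨_, hα e⟩

/-- The first dart of the vertex `(k, b)` of a chain. -/
def chainBase (G : CombMap D) (x y : D) (k : ℕ) (b : Bool) : D :=
  G.straight^[k] (bif b then x else y)

theorem chainBase_succ (x y : D) (k : ℕ) (b : Bool) :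
    G.chainBase x y (k + 1) b = G.σ (G.σ (G.α (G.chainBase x y k b))) :=
  Function.iterate_succ_apply' _ _ _

/-- The map from the darts of `chainMap (m + 1) s n` determined by a chain in `G`. -/
def chainHom (G : CombMap D) (m : ℕ) (s n : Bool) (x y : D) : ChainDart (m + 1) s n → D
  | .inner k b j => G.σ^[j.1] (G.chainBase x y k.1 b)
  | .south _ _ b false => G.α (G.σ (G.σ (G.chainBase x y 0 b)))
  | .south _ _ b true => G.α (G.σ (G.σ (G.σ (G.chainBase x y 0 b))))
  | .north _ _ b true => G.α (G.chainBase x y m b)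
  | .north _ _ b false => G.α (G.σ (G.chainBase x y m b))

theorem IsChain.chainHom_rot {m : ℕ} {s n : Bool} {x y : D} (h : G.IsChain m s n x y)
    (hG : G.IsTame) (d : ChainDart (m + 1) s n) :
    G.chainHom m s n x y d.rot = G.σ (G.chainHom m s n x y d) := by
  have h4 := hG.σ_four
  rcases d with ⟨k, b, j⟩ | ⟨hs, hm, b, r⟩ | ⟨hn, hm, b, r⟩
  · fin_cases j <;> simp [ChainDart.rot, chainHom, h4]
  · obtain ⟨h1, h2, h3⟩ := h.bot.1 hs
    cases r <;> cases b <;> simp only [ChainDart.rot, chainHom, chainBase] <;>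
      simp <;> grind
  · obtain ⟨h1, h2, h3⟩ := h.top.1 hn
    cases r <;> cases b <;> simp only [ChainDart.rot, chainHom, chainBase] <;>
      simp <;> grind

theorem IsChain.chainHom_flip {m : ℕ} {s n : Bool} {x y : D} (h : G.IsChain m s n x y)
    (hG : G.IsTame) (d : ChainDart (m + 1) s n) :
    G.chainHom m s n x y d.flip = G.α (G.chainHom m s n x y d) := by
  have h4 := hG.σ_four
  have ha := G.α_α
  have link : ∀ k < m, ∀ b, G.σ (G.α (G.chainBase x y k b)) =
      G.α (G.σ (G.chainBase x y k (!b))) := by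
    intro k hk b
    cases b
    · exact (h.link k hk).2
    · exact (h.link k hk).1
  rcases d with ⟨⟨k, hk⟩, b, j⟩ | ⟨hs, hm, b, r⟩ | ⟨hn, hm, b, r⟩
  · fin_cases j
    · by_cases h1 : k < m
      · simp [ChainDart.flip, h1, chainHom, chainBase_succ, h4]
      · obtain rfl : k = m := by omega
        by_cases hn : n = true
        · simp [ChainDart.flip, hn, chainHom]
        · have := h.top.2 (by simpa using hn)
          cases b <;> simp [ChainDart.flip, hn, chainHom, chainBase, this.1, this.2]
    · by_cases h1 : k < m
      · have := link k h1 (!b)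
        simp [ChainDart.flip, h1, chainHom, chainBase_succ, h4, this]
      · obtain rfl : k = m := by omega
        by_cases hn : n = true
        · simp [ChainDart.flip, hn, chainHom]
        · have := h.top.2 (by simpa using hn)
          cases b <;> simp [ChainDart.flip, hn, chainHom, chainBase, ← this.1, ← this.2, ha]
    · rcases k with _ | k
      · by_cases hs : s = true
        · simp [ChainDart.flip, hs, chainHom]
        · have := h.bot.2 (by simpa using hs)
          cases b <;> simp [ChainDart.flip, hs, chainHom, chainBase, this.1, this.2]
      · simp [ChainDart.flip, chainHom, chainBase_succ, h4, ha]
    · rcases k with _ | k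
      · by_cases hs : s = true
        · simp [ChainDart.flip, hs, chainHom]
        · have := h.bot.2 (by simpa using hs)
          cases b <;> simp [ChainDart.flip, hs, chainHom, chainBase, ← this.1, ← this.2, ha]
      · have := link k (by omega) b
        simp [ChainDart.flip, chainHom, chainBase_succ, h4, ha, this]
  · cases r <;> simp [ChainDart.flip, chainHom, ha]
  · cases r <;> simp [ChainDart.flip, chainHom, ha]

/-! ### Propagation of nested circles. -/

/-- Parallel edges between the tails of `x` and `y` that form a circle. -/
def IsCircle (G : CombMap D) (x y : D) : Prop :=
  G.α (G.σ x) = G.σ (G.σ (G.σ y)) ∧ G.α (G.σ y) = G.σ (G.σ (G.σ x))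

/-- The darts `x` and `y` point outwards from a circle through two vertices, and the part `B` of the
map is attached to these two vertices only. -/
structure InflationState (G : CombMap D) (x y : D) (B : Set G.Vertex) : Prop where
  circle : G.IsCircle x y
  x_notMem : G.vertexOf x ∉ B
  y_notMem : G.vertexOf y ∉ B
  exit : ∀ d, G.vertexOf d ∈ B → G.vertexOf (G.α d) ∈ B ∨
    G.vertexOf (G.α d) = G.vertexOf x ∨ G.vertexOf (G.α d) = G.vertexOf y
  x0 : G.vertexOf (G.α x) ∈ B
  y0 : G.vertexOf (G.α y) ∈ B
  x2 : G.vertexOf (G.α (G.σ (G.σ x))) ∉ B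
  y2 : G.vertexOf (G.α (G.σ (G.σ y))) ∉ B

theorem InflationState.swap {x y : D} {B : Set G.Vertex} (h : G.InflationState x y B) :
    G.InflationState y x B :=
  ⟨h.circle.symm, h.y_notMem, h.x_notMem, fun d hd => by have := h.exit d hd; tauto, h.y0, h.x0,
    h.y2, h.x2⟩

/-- With equal heads, rigidity would make both faces outside the circle triangles, `σ (α y) = α x`
and `σ (α x) = α y`, so `σ ∘ σ` would fix `α x`. -/
theorem InflationState.heads_ne {x y : D} {B : Set G.Vertex} (h : G.InflationState x y B)
    (hG : G.IsRigid) : G.vertexOf (G.α x) ≠ G.vertexOf (G.α y) := by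
  intro heq
  have ha := G.α_α
  have h1 : G.σ (G.α y) = G.α x := by
    refine hG.eq_of_faceOf _ _ (by rw [vertexOf_σ, heq]) ?_
    rw [faceOf_σ_α, ← faceOf_σ_α (G.α x), ha, ← faceOf_σ_α (G.σ x), h.circle.1, hG.σ_four]
  have h2 : G.σ (G.α x) = G.α y := by
    refine hG.eq_of_faceOf _ _ (by rw [vertexOf_σ, heq]) ?_
    rw [faceOf_σ_α, ← faceOf_σ_α (G.α y), ha, ← faceOf_σ_α (G.σ y), h.circle.2, hG.σ_four]
  exact hG.σ_σ_ne (G.α x) (by rw [h2, h1])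

/-- The face runs along `α x`, `σ x`, `y`. As a 2-gon it would put the tail of `y` into `B`; as a
triangle it would make the two heads equal. -/
theorem InflationState.quad {x y : D} {B : Set G.Vertex} (h : G.InflationState x y B)
    (hG : G.IsRigid) : G.σ (G.α (G.σ (G.α y))) = G.α x := by
  have h1 := hG.face (G.α x)
  have h2 := h.heads_ne hG
  rw [G.α_α, h.circle.1, hG.σ_four] at h1
  rcases h1 with h1 | h1 | h1
  · exact (h.y_notMem (h1 ▸ h.x0)).elim
  · exact (h2 (by rw [← h1, vertexOf_σ])).elim
  · exact h1

theorem InflationState.next_circle {x y : D} {B : Set G.Vertex} (h : G.InflationState x y B)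
    (hG : G.IsRigid) : G.IsCircle (G.straight x) (G.straight y) := by
  have h1 := h.quad hG
  have h2 := h.swap.quad hG
  have h4 := hG.σ_four
  have ha := G.α_α
  simp only [IsCircle, straight]
  grind

theorem InflationState.head_mem {x y : D} {B : Set G.Vertex} (h : G.InflationState x y B)
    (hG : G.IsRigid) (hX : G.α (G.straight x) ≠ G.straight y) :
    G.vertexOf (G.α (G.straight x)) ∈ B \ {G.vertexOf (G.α x), G.vertexOf (G.α y)} := by
  have h1 := h.quad hG
  have h2 := h.swap.quad hG
  have h3 := h.heads_ne hG
  have h4 := hG.σ_four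
  have ha := G.α_α
  have hv := G.vertexOf_σ
  have hne2 := hG.σ_σ_ne
  have hat := hG.eq_of_vertexOf
  have hl := hG.no_loop (G.straight x)
  obtain ⟨⟨c1, c2⟩, hx, hy, hex, x0, y0, x2, y2⟩ := h
  have hex := hex (G.straight x) (by simpa [straight] using x0)
  have hy' : G.vertexOf (G.α (G.straight x)) ≠ G.vertexOf (G.α y) := by
    intro h
    have := hat _ _ h.symm
    simp only [straight] at *
    clear hat hl hex
    grind
  refine ⟨?_, ?_⟩
  · rcases hex with h | h | h
    · exact h
    · have := hat _ _ h.symm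
      simp only [straight] at *
      clear hat hl
      grind
    · have := hat _ _ h.symm
      simp only [straight] at *
      clear hat hl
      grind
  · rintro (h | h)
    · exact hl (h.trans (by simp [straight]))
    · exact hy' h

theorem InflationState.next {x y : D} {B : Set G.Vertex} (h : G.InflationState x y B)
    (hG : G.IsRigid) (hX : G.α (G.straight x) ≠ G.straight y) :
    G.InflationState (G.straight x) (G.straight y)
      (B \ {G.vertexOf (G.α x), G.vertexOf (G.α y)}) where
  circle := h.next_circle hG
  x_notMem hx := hx.2 (Or.inl (by simp [straight]))
  y_notMem hy := hy.2 (Or.inr (by simp [straight]))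
  exit d hd := by
    have hat := hG.eq_of_vertexOf
    have ha := G.α_α
    have hX : G.vertexOf (G.straight x) = G.vertexOf (G.α x) := by simp [straight]
    have hY : G.vertexOf (G.straight y) = G.vertexOf (G.α y) := by simp [straight]
    have hx := h.x_notMem
    have hy := h.y_notMem
    rw [hX, hY]
    rcases h.exit d hd.1 with hd' | hd' | hd'
    · simp only [Set.mem_sdiff, Set.mem_insert_iff, Set.mem_singleton_iff]
      tauto
    · exfalso
      have hd0 := hd.1
      rw [← ha d] at hd hd0
      rcases hat _ _ hd'.symm with h' | h' | h' | h' <;> rw [h'] at hd hd0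
      · exact hd.2 (Or.inl rfl)
      · rw [h.circle.1] at hd0; simp at hd0; exact hy hd0
      · exact h.x2 hd0
      · rw [← h.circle.2, ha] at hd0; simp at hd0; exact hy hd0
    · exfalso
      have hd0 := hd.1
      rw [← ha d] at hd hd0
      rcases hat _ _ hd'.symm with h' | h' | h' | h' <;> rw [h'] at hd hd0
      · exact hd.2 (Or.inr rfl)
      · rw [h.circle.2] at hd0; simp at hd0; exact hx hd0
      · exact h.y2 hd0
      · rw [← h.circle.1, ha] at hd0; simp at hd0; exact hx hd0
  x0 := h.head_mem hG hX
  y0 := by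
    rw [Set.pair_comm]
    exact h.swap.head_mem hG fun hY => hX (by rw [← hY, G.α_α])
  x2 hx := by
    rw [straight, hG.σ_four, G.α_α] at hx
    exact h.x_notMem hx.1
  y2 hy := by
    rw [straight, hG.σ_four, G.α_α] at hy
    exact h.y_notMem hy.1

/-- The initial circle lies outside `B`, so the `m` further circles account for `2 * m` vertices of
`B`. -/
theorem InflationState.exists_cap [Finite D] (hG : G.IsRigid) {x y : D} {B : Set G.Vertex}
    (h : G.InflationState x y B) :
    ∃ m, (∀ k ≤ m, G.IsCircle (G.straight^[k] x) (G.straight^[k] y)) ∧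
      G.α (G.straight^[m] x) = G.straight^[m] y ∧ 1 ≤ m ∧ 2 * m ≤ B.ncard := by
  induction hN : B.ncard using Nat.strong_induction_on generalizing x y B with
  | _ N ih =>
  have h2 : ({G.vertexOf (G.α x), G.vertexOf (G.α y)} : Set G.Vertex) ⊆ B := by
    rintro w (rfl | rfl)
    exacts [h.x0, h.y0]
  have h3 := Set.ncard_pair (h.heads_ne hG)
  have h4 := Set.ncard_le_ncard h2
  by_cases hX : G.α (G.straight x) = G.straight y
  · refine ⟨1, ?_, hX, le_rfl, by omega⟩
    rintro (_ | k) hk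
    · exact h.circle
    · obtain rfl : k = 0 := by omega
      exact h.next_circle hG
  · have h5 := Set.ncard_sdiff h2
    obtain ⟨m, h6, h7, h8, h9⟩ := ih _ (by omega) (h.next hG hX) rfl
    refine ⟨m + 1, ?_, h7, by omega, by omega⟩
    rintro (_ | k) hk
    · exact h.circle
    · exact h6 k (by omega)

/-- The map from the darts of `inflationMap (m + 1)` determined by `m + 1` nested circles in `G`. -/
def inflationHom (G : CombMap D) (m : ℕ) (x y : D) : Fin (m + 1) × Bool × Fin 4 → D :=
  fun d => G.σ^[d.2.2.1] (G.chainBase x y d.1.1 d.2.1)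

theorem inflationHom_σ (hG : G.IsTame) {m : ℕ} {x y : D} (d : Fin (m + 1) × Bool × Fin 4) :
    G.inflationHom m x y ((inflationMap (m + 1)).σ d) = G.σ (G.inflationHom m x y d) := by
  obtain ⟨k, b, j⟩ := d
  have h4 := hG.σ_four
  fin_cases j <;> simp [inflationMap, inflationHom, h4]

theorem inflationHom_α (hG : G.IsTame) {m : ℕ} {x y : D}
    (hc : ∀ k ≤ m, G.IsCircle (G.straight^[k] x) (G.straight^[k] y))
    (htop : G.α (G.straight^[m] x) = G.straight^[m] y)
    (hbot : G.α (G.σ (G.σ x)) = G.σ (G.σ y)) (d : Fin (m + 1) × Bool × Fin 4) :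
    G.inflationHom m x y (inflationFlip (m + 1) d) = G.α (G.inflationHom m x y d) := by
  have h4 := hG.σ_four
  have ha := G.α_α
  have circ : ∀ k ≤ m, ∀ b, G.α (G.σ (G.chainBase x y k b)) =
      G.σ (G.σ (G.σ (G.chainBase x y k (!b)))) := by
    intro k hk b
    cases b
    · exact (hc k hk).2
    · exact (hc k hk).1
  obtain ⟨⟨k, hk⟩, b, j⟩ := d
  fin_cases j
  · by_cases h1 : k < m
    · simp [inflationFlip, h1, inflationHom, chainBase_succ, h4]
    · obtain rfl : k = m := by omega
      cases b
      · simp [inflationFlip, inflationHom, chainBase, ← htop, ha]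
      · simp [inflationFlip, inflationHom, chainBase, htop]
  · simp [inflationFlip, inflationHom, circ k (by omega)]
  · rcases k with _ | k
    · cases b
      · simp [inflationFlip, inflationHom, chainBase, ← hbot, ha]
      · simp [inflationFlip, inflationHom, chainBase, hbot]
    · simp [inflationFlip, inflationHom, chainBase_succ, h4, ha]
  · have := circ k (by omega) (!b)
    rw [Bool.not_not] at this
    simp [inflationFlip, inflationHom, ← this, ha]

/-! ### The edges around a separating pair. -/

/-- Otherwise the tail of `y` alone would cut `A` off. -/
theorem Separates.exists_dart {x y : D} {A B : Set G.Vertex} (h : G.Separates x y A B)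
    (hG : G.IsRigid) (hA : A.Nonempty) : ∃ e, G.vertexOf e = G.vertexOf x ∧
      G.vertexOf (G.α e) ∈ A := by
  by_contra! hcon
  refine h.left_notMem_left (hG.noCutVertex (G.vertexOf y) A hA h.right_notMem_left ?_ _ h.ne)
  intro d hd
  rcases h.cover (G.vertexOf (G.α d)) with h' | h' | h' | h'
  · exact Or.inl h'
  · exact (h.edge d hd h').elim
  · exact (hcon _ h' (by rwa [G.α_α])).elim
  · exact Or.inr h'

/-- The tail of `x` has at least two edges to `A`. -/
def HasTwo (G : CombMap D) (x : D) (A : Set G.Vertex) : Prop :=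
  ∃ e e', e ≠ e' ∧ G.vertexOf e = G.vertexOf x ∧ G.vertexOf e' = G.vertexOf x ∧
    G.vertexOf (G.α e) ∈ A ∧ G.vertexOf (G.α e') ∈ A

theorem HasTwo.cases {x f : D} {A : Set G.Vertex} (h : G.HasTwo x A) (hG : G.IsTame)
    (hf : G.vertexOf f = G.vertexOf x) (hfA : G.vertexOf (G.α f) ∉ A) :
    G.vertexOf (G.α (G.σ f)) ∈ A ∧ G.vertexOf (G.α (G.σ (G.σ f))) ∈ A ∨
    G.vertexOf (G.α (G.σ f)) ∈ A ∧ G.vertexOf (G.α (G.σ (G.σ (G.σ f)))) ∈ A ∨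
    G.vertexOf (G.α (G.σ (G.σ f))) ∈ A ∧ G.vertexOf (G.α (G.σ (G.σ (G.σ f)))) ∈ A := by
  obtain ⟨e, e', hne, he, he', hA, hA'⟩ := h
  have h1 := hG.eq_of_vertexOf f e (hf.trans he.symm)
  have h2 := hG.eq_of_vertexOf f e' (hf.trans he'.symm)
  grind

/-- An edge to `B` does not lie between two edges to `A`. -/
theorem Separates.not_between {x y e : D} {A B : Set G.Vertex} [Finite D]
    (h : G.Separates x y A B) (hp : G.IsPlane) (hG : G.IsRigid) (hy : G.HasTwo y A)
    (he : G.vertexOf e = G.vertexOf x) (h0 : G.vertexOf (G.α e) ∈ B)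
    (h1 : G.vertexOf (G.α (G.σ e)) ∈ A) (h3 : G.vertexOf (G.α (G.σ (G.σ (G.σ e)))) ∈ A) :
    False := by
  have h4 := hG.σ_four
  have ha := G.α_α
  have hv := G.vertexOf_σ
  have hne := hG.σ_ne
  have hne2 := hG.σ_σ_ne
  have hat := hG.eq_of_vertexOf
  have hdj := Set.disjoint_left.1 h.disj
  -- The faces on the two sides of `e` both return through the tail of `y`, at the corners `w` and
  -- `z`. The cases below are the four positions of `z` relative to `w`.
  obtain ⟨w, w0, w1, w2, w3, w4⟩ := h.symm.corner hG he h0 h1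
  obtain ⟨z, z0, z1, z2, z3, z4⟩ := h.corner hG (e := G.σ (G.σ (G.σ e))) (by simpa using he) h3
    (by rwa [h4])
  rw [h4] at z0
  have z5 : G.α (G.σ (G.σ (G.σ z))) = G.σ (G.α e) := by rw [z0, h4, ha]
  rcases hat w z (w2.trans z2.symm) with h' | h' | h' | h'
  · exact hdj z3 (h' ▸ w3)
  · rw [h', h4] at z5
    exact hne2 (G.α e) (by rw [← z5, w1])
  -- Here `e` is the only edge from the tail of `x` to `B`, and `w`, `σ w` are the only ones from
  -- the tail of `y`. All three end at the head of `e`, whose fourth edge leads into `B`, so this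
  -- head is a cut vertex.
  · have hx2 : G.vertexOf (G.α (G.σ (G.σ e))) ∉ B := by
      intro hB
      obtain ⟨w', -, p1, p2, p3, p4⟩ := h.symm.corner hG (e := G.σ (G.σ e)) (by simpa using he) hB
        h3
      rcases hat w w' (w2.trans p2.symm) with h'' | h'' | h'' | h''
      · rw [h'', w1] at p1
        exact hne2 e (G.α.injective p1).symm
      · rw [h'', h4] at p4
        exact hdj p4 w3
      · rw [h'', ← h'] at p3
        exact hdj z3 p3
      · rw [h''] at p3
        exact hdj w4 p3
    have hz : G.σ (G.σ (G.σ z)) = G.σ w := by rw [h', h4]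
    rw [hz] at z4 z5
    have eB : ∀ d, G.vertexOf d = G.vertexOf x → G.vertexOf (G.α d) ∈ B → d = e := by
      intro d hd hdB
      rcases hat e d (he.trans hd.symm) with rfl | rfl | rfl | rfl
      · rfl
      · exact (hdj h1 hdB).elim
      · exact (hx2 hdB).elim
      · exact (hdj h3 hdB).elim
    have yB : ∀ d, G.vertexOf d = G.vertexOf y → G.vertexOf (G.α d) ∈ B → d = w ∨ d = G.σ w := by
      intro d hd hdB
      rcases hat w d (w2.trans hd.symm) with rfl | rfl | rfl | rfl
      · exact Or.inl rfl
      · exact Or.inr rfl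
      · exact (hdj z3 (h' ▸ hdB)).elim
      · exact (hdj w4 hdB).elim
    have hbw : G.vertexOf (G.α w) = G.vertexOf (G.α e) := by rw [← w1, hv]
    have hbz : G.vertexOf (G.α (G.σ w)) = G.vertexOf (G.α e) := by rw [z5, hv]
    have hmem : G.vertexOf (G.α (G.σ (G.σ (G.α e)))) ∈ B := by
      have hbe : G.vertexOf (G.σ (G.σ (G.α e))) ∈ B := by simpa using h0
      rcases h.cover (G.vertexOf (G.α (G.σ (G.σ (G.α e))))) with c | c | c | c
      · exact (h.edge' _ hbe c).elim
      · exact c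
      · have := eB _ c (by rwa [ha])
        exact (hne2 (G.α e) (by simpa only [ha] using congrArg G.α this)).elim
      · rcases yB _ c (by rwa [ha]) with h'' | h''
        · have h5 : G.σ (G.σ (G.α e)) = G.α w := by rw [← h'', ha]
          rw [← w1] at h5
          exact (hne (G.α w) (by conv_lhs => rw [← h5, h4])).elim
        · have h5 : G.σ (G.σ (G.α e)) = G.α (G.σ w) := by rw [← h'', ha]
          rw [z5] at h5
          exact (hne _ h5).elim
    refine h.left_notMem_right (hG.noCutVertex (G.vertexOf (G.α e)) (B \ {G.vertexOf (G.α e)})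
      ⟨_, hmem, fun hl => hG.no_loop _ (hl.trans (by simp))⟩ (by simp) ?_ (G.vertexOf x)
      fun heq => h.left_notMem_right (heq ▸ h0)).1
    rintro d ⟨hd, hd'⟩
    have hd0 : G.vertexOf (G.α (G.α d)) ∈ B := by rwa [ha]
    rcases h.cover (G.vertexOf (G.α d)) with c | c | c | c
    · exact (h.edge' _ hd c).elim
    · by_cases hc : G.vertexOf (G.α d) = G.vertexOf (G.α e)
      · exact Or.inr hc
      · exact Or.inl ⟨c, hc⟩
    · refine (hd' ?_).elim
      rw [← eB _ c hd0, ha]; rfl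
    · refine (hd' ?_).elim
      rcases yB _ c hd0 with h'' | h''
      · rw [← ha d, h'']; exact hbw
      · rw [← ha d, h'']; exact hbz
  -- Here `A` and `B` alternate around the tail of `y`. The edges of `e` and `z` share both faces
  -- and so form an edge cut, but `σ (σ e)` is parallel to `e` and avoids the cut.
  · have hsw : G.vertexOf (G.α (G.σ w)) ∈ A := by
      have := hy.cases hG.toIsTame w2 fun hc => hdj hc w3
      have h6 : G.vertexOf (G.α (G.σ (G.σ w))) ∉ A := fun hc => hdj hc (by
        rw [h', h4] at z4; exact z4)
      tauto
    obtain ⟨w', -, p1, p2, p3, p4⟩ := h.swap.symm.corner hG w2 w3 hsw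
    have hw' : w' = G.σ (G.σ e) := by
      rcases hat e w' (he.trans p2.symm) with h'' | h'' | h'' | h''
      · rw [h'', ← w1] at p1
        exact (hne2 _ p1).elim
      · rw [h''] at p3; exact (hdj h1 p3).elim
      · exact h''
      · rw [h''] at p3; exact (hdj h3 p3).elim
    obtain ⟨g, g1, g2⟩ := hp.exists_potential_of_two_edges (d := e) (d' := z)
      (by rw [z0]; simp) (by
        rw [← faceOf_σ_α (G.α z), ha, h', h4, w0, faceOf_σ_α, faceOf_σ_α, ← faceOf_σ_α (G.α e), ha])
      (fun hc => h.ne (by rw [← he, hc, z2]))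
      (fun hc => h.left_notMem_left (by rw [← he, hc]; exact z3))
    refine g1 ?_
    have := g2 (G.σ (G.σ e)) (hne2 e) (fun hc => h.left_notMem_right (by
      rw [← he, ← hv e, ← hv (G.σ e), hc]; exact h0)) (fun hc => h.ne (by
      rw [← he, ← hv e, ← hv (G.σ e), hc, z2])) (fun hc => h.left_notMem_left (by
      rw [← he, ← hv e, ← hv (G.σ e), hc]; exact z3))
    rw [hv, hv, ← hw', ← hv (G.α w'), p1, ← hv (G.α w), w1] at this
    exact this

/-- The face from `A` through the tail of `x` to `B` returns at a corner `w` at the tail of `y`. The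
edge back from there to the tail of `x` has four possible positions relative to `w`. Two conflict
with the heads at `w`, one makes a neighbouring face too long, and one gives a face two corners at a
vertex. -/
theorem Separates.not_single_edge {x y e : D} {A B : Set G.Vertex}
    (h : G.Separates x y A B) (hG : G.IsRigid) (hy : G.HasTwo y A)
    (he : G.vertexOf e = G.vertexOf x) (h0 : G.vertexOf (G.α e) ∈ A)
    (h1 : G.vertexOf (G.α (G.σ e)) ∈ B)
    (h2 : G.vertexOf (G.α (G.σ (G.σ e))) = G.vertexOf y) : False := by
  have h4 := hG.σ_four
  have ha := G.α_α
  have hv := G.vertexOf_σ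
  have hdj := Set.disjoint_left.1 h.disj
  obtain ⟨w, w0, w1, w2, w3, w4⟩ := h.corner hG he h0 h1
  have hX : G.vertexOf (G.α (G.α (G.σ (G.σ e)))) = G.vertexOf x := by
    simpa [ha] using he
  rcases hG.eq_of_vertexOf w _ (w2.trans h2.symm) with h' | h' | h' | h'
  · rw [h'] at hX
    exact h.left_notMem_left (hX ▸ w3)
  · have hA : G.vertexOf (G.α (G.σ (G.σ w))) ∈ A := by
      have h5 := hy.cases hG.toIsTame (f := G.σ w) (by simpa using w2) (by
        rw [← h', hX]; exact h.left_notMem_left)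
      tauto
    have hf := hG.face (G.α (G.σ e))
    simp only [ha, h'] at hf
    rcases hf with hf | hf | hf
    · exact h.right_notMem_right (by rw [← w2, ← hv w, ← hv (G.σ w), hf]; exact h1)
    · refine hdj hA ?_
      rw [← hv, hf]; exact h1
    · refine h.edge (G.σ (G.α (G.σ (G.σ w)))) (by simpa using hA) ?_
      rw [← hv, hf]; exact h1
  · refine hG.σ_σ_ne (G.α (G.σ e)) (hG.eq_of_faceOf _ _ (by simp) ?_)
    have h7 : G.σ (G.σ (G.α (G.σ e))) = G.σ (G.α (G.σ (G.σ (G.σ w)))) := by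
      rw [w0, h4, ha]
    rw [h7, faceOf_σ_α, ← h', faceOf_σ_α, ← faceOf_σ_α (G.α (G.σ e)), ha]
  · rw [h'] at hX
    exact h.left_notMem_right (hX ▸ w4)

/-- At least two of the four heads lie in `A` and one in `B`. Since `A B A` and `A B y` are excluded
by `not_between` and `not_single_edge`, the cyclic word is `B B A A` or `B A A y`. -/
theorem Separates.word {x y : D} {A B : Set G.Vertex} [Finite D]
    (h : G.Separates x y A B) (hp : G.IsPlane) (hG : G.IsRigid) (hx : G.HasTwo x A)
    (hy : G.HasTwo y A) (hB : B.Nonempty) :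
    ∃ f, G.vertexOf f = G.vertexOf x ∧ G.vertexOf (G.α f) ∈ B ∧
      G.vertexOf (G.α (G.σ (G.σ f))) ∈ A ∧
      (G.vertexOf (G.α (G.σ f)) ∈ B ∧ G.vertexOf (G.α (G.σ (G.σ (G.σ f)))) ∈ A ∨
        G.vertexOf (G.α (G.σ f)) ∈ A ∧
          G.vertexOf (G.α (G.σ (G.σ (G.σ f)))) = G.vertexOf y) := by
  have h4 := hG.σ_four
  have hdj := Set.disjoint_left.1 h.disj
  obtain ⟨f, hf, hfB⟩ := h.symm.exists_dart hG hB
  have cov : ∀ d, G.vertexOf d = G.vertexOf x → G.vertexOf (G.α d) ∈ A ∨ G.vertexOf (G.α d) ∈ B ∨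
      G.vertexOf (G.α d) = G.vertexOf y := by
    intro d hd
    have := h.cover (G.vertexOf (G.α d))
    have := hG.no_loop d
    rw [hd] at this
    tauto
  have c1 := cov (G.σ f) (by simpa using hf)
  have c3 := cov (G.σ (G.σ (G.σ f))) (by simpa using hf)
  have hbet : ¬ (G.vertexOf (G.α (G.σ f)) ∈ A ∧ G.vertexOf (G.α (G.σ (G.σ (G.σ f)))) ∈ A) :=
    fun hc => h.not_between hp hG hy hf hfB hc.1 hc.2
  rcases hx.cases hG.toIsTame hf (fun hc => hdj hc hfB) with ⟨p, q⟩ | hc | ⟨p, q⟩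
  · rcases c3 with c | c | c
    · exact (hbet ⟨p, c⟩).elim
    · exact ⟨G.σ (G.σ (G.σ f)), by simpa using hf, c, by rwa [h4], Or.inl
        ⟨by rwa [h4], by rwa [h4]⟩⟩
    · exact ⟨f, hf, hfB, q, Or.inr ⟨p, c⟩⟩
  · exact (hbet hc).elim
  · rcases c1 with c | c | c
    · exact (hbet ⟨c, q⟩).elim
    · exact ⟨f, hf, hfB, p, Or.inl ⟨c, q⟩⟩
    · exact (h.not_single_edge hG hy (e := G.σ (G.σ (G.σ f))) (by simpa using hf) q
        (by rwa [h4]) (by rwa [h4])).elim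

/-- An edge joining the pair is visible at both ends, so the two words are of the same kind. In the
case of `B A A y`, the face through the corner `B A` at one vertex needs a corner `A B` at the
other, which the word there lacks. -/
theorem Separates.exists_chainState {x y : D} {A B : Set G.Vertex} [Finite D]
    (h : G.Separates x y A B) (hp : G.IsPlane) (hG : G.IsRigid) (hx : G.HasTwo x A)
    (hy : G.HasTwo y A) (hB : B.Nonempty) : ∃ x' y', G.ChainState x' y' A B := by
  have hdj := Set.disjoint_left.1 h.disj
  obtain ⟨f, f1, f2, f3, f4⟩ := h.word hp hG hx hy hB
  obtain ⟨g, g1, g2, g3, g4⟩ := h.swap.word hp hG hy hx hB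
  have hat := hG.eq_of_vertexOf
  have back : ∀ x y f g : D, G.Separates x y A B → G.vertexOf f = G.vertexOf x →
      G.vertexOf g = G.vertexOf y → G.vertexOf (G.α g) ∈ B →
      G.vertexOf (G.α (G.σ (G.σ g))) ∈ A → G.vertexOf (G.α (G.σ g)) ∈ B →
      G.vertexOf (G.α (G.σ (G.σ (G.σ g)))) ∈ A → G.vertexOf (G.α f) = G.vertexOf y → False := by
    intro x y f g h hf hg g0 g2 g1 g3 hfy
    have h0 : G.vertexOf (G.α (G.α f)) = G.vertexOf x := by rwa [G.α_α]
    rcases hat g _ (hg.trans hfy.symm) with h' | h' | h' | h' <;> rw [h'] at h0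
    · exact h.left_notMem_right (h0 ▸ g0)
    · exact h.left_notMem_right (h0 ▸ g1)
    · exact h.left_notMem_left (h0 ▸ g2)
    · exact h.left_notMem_left (h0 ▸ g3)
  rcases f4 with ⟨f4, f5⟩ | ⟨f4, f5⟩ <;> rcases g4 with ⟨g4, g5⟩ | ⟨g4, g5⟩
  · exact ⟨f, g, h.congr f1 g1, f2, f4, f3, f5, g2, g4, g3, g5⟩
  · exact (back _ _ _ f h.swap (by simpa using g1) f1 f2 f3 f4 f5 g5).elim
  · exact (back _ _ _ g h (by simpa using f1) g1 g2 g3 g4 g5 f5).elim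
  · exfalso
    obtain ⟨w, -, -, w2, w3, w4⟩ := h.symm.corner hG f1 f2 f4
    rcases hat g w (g1.trans w2.symm) with h' | h' | h' | h'
    · rw [h', g5] at w4
      exact h.left_notMem_left w4
    · rw [h'] at w3; exact hdj g4 w3
    · rw [h'] at w3; exact hdj g3 w3
    · rw [h', g5] at w3
      exact h.left_notMem_right w3

/-- If `A` is a single vertex that is joined to the tail of `x` by a single edge, the other edges
of this vertex form two `2`-gons. -/
theorem Separates.exists_inflationState {x y e : D} {A B : Set G.Vertex}
    (h : G.Separates x y A B) (hG : G.IsRigid) (hB : B.Nonempty)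
    (he : G.vertexOf e = G.vertexOf x) (heA : G.vertexOf (G.α e) ∈ A)
    (huniq : ∀ d, G.vertexOf d = G.vertexOf x → G.vertexOf (G.α d) ∈ A → d = e)
    (hA : ∀ w ∈ A, w = G.vertexOf (G.α e)) :
    ∃ x' y', G.α (G.σ (G.σ x')) = G.σ (G.σ y') ∧ G.vertexOf x' ≠ G.vertexOf y' ∧
      G.InflationState x' y' {G.vertexOf x', G.vertexOf y'}ᶜ := by
  have h4 := hG.σ_four
  have ha := G.α_α
  have hv := G.vertexOf_σ
  have hne := hG.σ_ne
  have hne2 := hG.σ_σ_ne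
  have hat := hG.eq_of_vertexOf
  have hdj := Set.disjoint_left.1 h.disj
  obtain ⟨f, hf, hfB⟩ := h.swap.symm.exists_dart hG hB
  have toY : ∀ d, G.vertexOf d = G.vertexOf (G.α e) → d ≠ G.α e →
      G.vertexOf (G.α d) = G.vertexOf y := by
    intro d hd hde
    have hdA : G.vertexOf d ∈ A := hd ▸ heA
    rcases h.cover (G.vertexOf (G.α d)) with c | c | c | c
    · exact (hG.no_loop d ((hA _ c).trans hd.symm)).elim
    · exact (h.edge _ hdA c).elim
    · have := huniq _ c (by rwa [ha])
      exact (hde (by rw [← this, ha])).elim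
    · exact c
  have p1 := toY (G.σ (G.α e)) (hv _) (hne _)
  have p2 := toY (G.σ (G.σ (G.α e))) (by simp) (hne2 _)
  have p3 := toY (G.σ (G.σ (G.σ (G.α e)))) (by simp) (by
    intro hc
    have := congrArg G.σ hc
    rw [h4] at this
    exact hne _ this.symm)
  have q1 := hat f _ (hf.trans p1.symm)
  have q2 := hat f _ (hf.trans p2.symm)
  have q3 := hat f _ (hf.trans p3.symm)
  have heB : G.vertexOf (G.α e) ∉ B := fun hc => hdj heA hc
  have toE : G.vertexOf (G.α (G.σ f)) = G.vertexOf (G.α e) ∧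
      G.vertexOf (G.α (G.σ (G.σ f))) = G.vertexOf (G.α e) ∧
      G.vertexOf (G.α (G.σ (G.σ (G.σ f)))) = G.vertexOf (G.α e) := by
    clear hat toY huniq hA hdj p1 p2 p3
    grind
  obtain ⟨t1, t2, t3⟩ := toE
  have r1 : G.σ (G.α (G.σ (G.σ f))) = G.α (G.σ f) := by
    refine hG.eq_of_faceOf _ _ (by rw [hv, t2, t1]) ?_
    rw [faceOf_σ_α, ← faceOf_σ_α (G.α (G.σ f)), ha]
  have r2 : G.σ (G.α (G.σ (G.σ (G.σ f)))) = G.α (G.σ (G.σ f)) := by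
    refine hG.eq_of_faceOf _ _ (by rw [hv, t3, t2]) ?_
    rw [faceOf_σ_α, ← faceOf_σ_α (G.α (G.σ (G.σ f))), ha]
  have hxy : G.vertexOf x ≠ G.vertexOf y := h.ne
  have r3 : G.σ (G.α (G.σ f)) = G.α e := by
    have hev : G.vertexOf (G.α (G.α e)) ≠ G.vertexOf y := by rwa [ha, he]
    rcases hat (G.α (G.σ f)) (G.α e) t1 with h' | h' | h' | h'
    · exact (hev (by rw [h', ha, hv, hf])).elim
    · exact h'.symm
    · rw [← r1, ← r2, h4] at h'
      exact (hev (by rw [h', ha, hv, hv, hv, hf])).elim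
    · rw [← r1, h4] at h'
      exact (hev (by rw [h', ha, hv, hv, hf])).elim
  have s1 : G.α e = G.σ (G.σ (G.α (G.σ (G.σ f)))) := by rw [r1, r3]
  have s2 : G.α e = G.σ (G.σ (G.σ (G.α (G.σ (G.σ (G.σ f)))))) := by rw [r2, r1, r3]
  have hfe : G.vertexOf f ≠ G.vertexOf (G.α e) := fun hc => h.right_notMem_left (by
    rw [← hf, hc]; exact heA)
  -- The circle consists of the outer two of the three parallel edges, and the middle one closes it
  -- inside. The outward darts are the remaining dart `f` at the tail of `y` and the dart back to
  -- the tail of `x`.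
  refine ⟨f, G.α e, by rw [s1, h4], hfe, ⟨?_, ?_⟩, by simp, by simp, ?_, ?_, ?_, ?_, ?_⟩
  · rw [← r3, h4]
  · rw [s2, h4, ha]
  · intro d _
    by_cases c1 : G.vertexOf (G.α d) = G.vertexOf f
    · exact Or.inr (Or.inl c1)
    · by_cases c2 : G.vertexOf (G.α d) = G.vertexOf (G.α e)
      · exact Or.inr (Or.inr c2)
      · exact Or.inl (by simp [c1, c2])
  · rintro (c | c)
    · exact hG.no_loop f c
    · exact heB ((show G.vertexOf (G.α f) = _ from c) ▸ hfB)
  · rintro (c | c)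
    · rw [ha, he, hf] at c; exact hxy c
    · exact hG.no_loop _ c
  · intro c
    exact c (Or.inr t2)
  · intro c
    refine c (Or.inl ?_)
    rw [s1, h4, ha, hv, hv]

theorem Separates.ncard [Finite D] {x y : D} {A B : Set G.Vertex} (h : G.Separates x y A B) :
    A.ncard + B.ncard + 2 = Nat.card G.Vertex := by
  rw [← Set.ncard_union_eq h.disj, ← Set.ncard_pair h.ne, ← Set.ncard_union_eq, ← Set.ncard_univ]
  · congr 1
    ext w
    have := h.cover w
    simp only [Set.mem_union, Set.mem_insert_iff, Set.mem_singleton_iff, Set.mem_univ, iff_true]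
    tauto
  · refine Set.disjoint_left.2 ?_
    rintro w (hw | hw) (rfl | rfl)
    exacts [h.left_notMem_left hw, h.right_notMem_left hw, h.left_notMem_right hw,
      h.right_notMem_right hw]

/-- Since `e` is the only edge from the tail of `x` to `A`, its head can take over as separating
vertex while the tail of `x` joins `B`. For minimal `A` this forces `A` to be a single vertex. -/
theorem Separates.shrink {x y e : D} {A B : Set G.Vertex} (h : G.Separates x y A B)
    (heA : G.vertexOf (G.α e) ∈ A)
    (huniq : ∀ d, G.vertexOf d = G.vertexOf x → G.vertexOf (G.α d) ∈ A → d = e) :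
    G.Separates (G.α e) y (A \ {G.vertexOf (G.α e)}) (B ∪ {G.vertexOf x}) where
  ne hc := h.right_notMem_left (hc ▸ heA)
  cover w := by
    have := h.cover w
    simp only [Set.mem_union, Set.mem_sdiff, Set.mem_singleton_iff]
    tauto
  disj := by
    refine Set.disjoint_left.2 ?_
    rintro w ⟨hw, -⟩ (hw' | rfl)
    · exact Set.disjoint_left.1 h.disj hw hw'
    · exact h.left_notMem_left hw
  left_notMem_left hc := hc.2 rfl
  left_notMem_right := by
    rintro (hc | hc)
    · exact Set.disjoint_left.1 h.disj heA hc
    · exact h.left_notMem_left ((show G.vertexOf (G.α e) = _ from hc) ▸ heA)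
  right_notMem_left hc := h.right_notMem_left hc.1
  right_notMem_right := by
    rintro (hc | hc)
    · exact h.right_notMem_right hc
    · exact h.ne hc.symm
  edge := by
    rintro d ⟨hd, hd'⟩ (hc | hc)
    · exact h.edge d hd hc
    · refine hd' ?_
      rw [← huniq _ hc (by rwa [G.α_α]), G.α_α]
      rfl

/-! ### Structure of a map with a separating pair. -/

/-- The darts `x` and `y` point outwards from the innermost of `m + 1` nested circles. -/
structure IsInflation (G : CombMap D) (m : ℕ) (x y : D) : Prop where
  circle : ∀ k ≤ m, G.IsCircle (G.straight^[k] x) (G.straight^[k] y)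
  top : G.α (G.straight^[m] x) = G.straight^[m] y
  bot : G.α (G.σ (G.σ x)) = G.σ (G.σ y)

/-- The structure of a tame plane map with a separating pair of vertices. -/
theorem Separates.exists_structure [Finite D] {x y : D} {A B : Set G.Vertex}
    (h : G.Separates x y A B) (hp : G.IsPlane) (hG : G.IsRigid) (hA : A.Nonempty)
    (hB : B.Nonempty) :
    (∃ m x y, G.IsInflation m x y ∧ 1 ≤ m ∧ 2 * (m + 1) ≤ Nat.card G.Vertex) ∨
    ∃ m s n x y, G.IsChain m s n x y ∧
      2 * (m + 1) + s.toNat + n.toNat ≤ Nat.card G.Vertex := by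
  have h4 := hG.σ_four
  have ha := G.α_α
  let P : Set G.Vertex → Prop := fun A => A.Nonempty ∧ ∃ x y B, B.Nonempty ∧ G.Separates x y A B
  obtain ⟨A, ⟨hA, x, y, B, hB, h⟩, hmin⟩ :=
    exists_minimal_of_wellFoundedLT P ⟨A, hA, x, y, B, hB, h⟩
  have one : ∀ x y, G.Separates x y A B → ¬ G.HasTwo x A →
      ∃ m x y, G.IsInflation m x y ∧ 1 ≤ m ∧ 2 * (m + 1) ≤ Nat.card G.Vertex := by
    intro x y h hx
    obtain ⟨e, he, heA⟩ := h.exists_dart hG hA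
    have huniq : ∀ d, G.vertexOf d = G.vertexOf x → G.vertexOf (G.α d) ∈ A → d = e := by
      intro d hd hdA
      by_contra hde
      exact hx ⟨d, e, hde, hd, he, hdA, heA⟩
    have hone : ∀ w ∈ A, w = G.vertexOf (G.α e) := by
      intro w hw
      by_contra hwe
      exact (hmin (y := A \ {G.vertexOf (G.α e)}) ⟨⟨w, hw, hwe⟩, _, _, _, ⟨_, Or.inr rfl⟩,
        h.shrink heA huniq⟩ Set.sdiff_subset heA).2 rfl
    obtain ⟨x', y', h1, h2, h3⟩ := h.exists_inflationState hG hB he heA huniq hone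
    obtain ⟨m, h5, h6, h7, h8⟩ := h3.exists_cap hG
    refine ⟨m, x', y', ⟨h5, h6, h1⟩, h7, ?_⟩
    have h9 := Set.ncard_add_ncard_compl {G.vertexOf x', G.vertexOf y'}
    rw [Set.ncard_pair h2] at h9
    omega
  by_cases hx : G.HasTwo x A
  swap
  · exact Or.inl (one _ _ h hx)
  by_cases hy : G.HasTwo y A
  swap
  · exact Or.inl (one _ _ h.swap hy)
  right
  obtain ⟨x', y', hs⟩ := h.exists_chainState hp hG hx hy hB
  obtain ⟨m, n, h1, h2, h3⟩ := hs.exists_cap hG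
  have hcard := hs.ncard
  have ht := hs.turn hG.toIsTame
  -- The chain through `B` is complete. Turned towards `A`, one step gives a pole or a 2-gon; a
  -- continuing state would be a separation with a smaller part than `A`.
  rcases ht.step hG with hp | ⟨hl, hb, hd | ht'⟩
  · refine ⟨m, true, n, x', y', ⟨h1, h2, fun _ => hp, by simp⟩, ?_⟩
    have : 0 < A.ncard := (Set.ncard_pos).2 hA
    simp only [Bool.toNat_true]
    omega
  · have hx0 : G.straight (G.α (G.σ (G.σ x'))) = x' := by rw [straight, ha, h4]
    have hy0 : G.straight (G.α (G.σ (G.σ y'))) = y' := by rw [straight, ha, h4]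
    -- `straight` sends these darts to `x'` and `y'`: the chain starts one level lower, at the pair
    -- in `A` that carries the 2-gon.
    refine ⟨m + 1, false, n, G.α (G.σ (G.σ x')), G.α (G.σ (G.σ y')), ⟨?_, ?_, by simp, fun _ => hd⟩,
      ?_⟩
    · rintro (_ | k) hk
      · refine ⟨?_, ?_⟩
        · change G.σ (G.α (G.α _)) = G.α (G.σ (G.α _))
          rw [ha, hl.2, ha]
        · change G.σ (G.α (G.α _)) = G.α (G.σ (G.α _))
          rw [ha, hl.1, ha]
      · rw [Function.iterate_succ_apply, Function.iterate_succ_apply, hx0, hy0]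
        exact h1 k (by omega)
    · rw [Function.iterate_succ_apply, Function.iterate_succ_apply, hx0, hy0]
      exact h2
    · have h5 : ({G.vertexOf (G.α (G.σ (G.σ x'))), G.vertexOf (G.α (G.σ (G.σ y')))} :
          Set G.Vertex) ⊆ A := by
        rintro w (rfl | rfl)
        exacts [ht.x0, ht.y0]
      have h6 := Set.ncard_le_ncard h5
      rw [Set.ncard_pair hb] at h6
      simp only [Bool.toNat_false]
      omega
  · exact ((hmin ⟨⟨_, ht'.x0⟩, _, _, _, ⟨_, ht'.x2⟩, ht'.toSeparates.symm⟩ Set.sdiff_subset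
      ht.x0).2 (Or.inl rfl)).elim

/-! ### Counting darts and identifying `G` with a model. -/

theorem natCard_darts [Finite D] (h : ∀ v, G.degree v = 4) :
    Nat.card D = 4 * Nat.card G.Vertex := by
  have := Fintype.ofFinite G.Vertex
  rw [Nat.card_congr (Equiv.sigmaFiberEquiv G.vertexOf).symm, Nat.card_sigma]
  have h' : ∀ v, Nat.card {d // G.vertexOf d = v} = 4 := h
  simp [h', Nat.card_eq_fintype_card, mul_comm]

/-- The darts of a chain, as a sum of products. -/
def chainDartEmb {m : ℕ} {s n : Bool} : ChainDart m s n →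
    (Fin m × Bool × Fin 4) ⊕ (Fin s.toNat × Bool × Bool) ⊕ (Fin n.toNat × Bool × Bool)
  | .inner k b j => .inl (k, b, j)
  | .south hs _ b r => .inr (.inl (⟨0, by simp [hs]⟩, b, r))
  | .north hn _ b r => .inr (.inr (⟨0, by simp [hn]⟩, b, r))

theorem chainDartEmb_bijective {m : ℕ} {s n : Bool} (hm : 0 < m) :
    Function.Bijective (chainDartEmb : ChainDart m s n → _) := by
  constructor
  · rintro (_ | _ | _) (_ | _ | _) h <;> simp_all [chainDartEmb]
  · rintro (⟨k, b, j⟩ | ⟨k, b, r⟩ | ⟨k, b, r⟩)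
    · exact ⟨.inner k b j, rfl⟩
    · cases s
      · exact k.elim0
      · exact ⟨.south rfl hm b r, by rw [Subsingleton.elim (α := Fin 1) k 0]; rfl⟩
    · cases n
      · exact k.elim0
      · exact ⟨.north rfl hm b r, by rw [Subsingleton.elim (α := Fin 1) k 0]; rfl⟩

theorem natCard_chainDart {m : ℕ} {s n : Bool} (hm : 0 < m) :
    Nat.card (ChainDart m s n) = 4 * (2 * m + s.toNat + n.toNat) := by
  rw [Nat.card_congr (Equiv.ofBijective _ (chainDartEmb_bijective hm))]
  simp
  ring

/-- The lower bound on the number of vertices says that the model has at most as many darts as `G`.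
The surjection is then a bijection, and the bound becomes an equality. -/
theorem IsChain.exists_equiv [Finite D] {m : ℕ} {s n : Bool} {x y : D} (h : G.IsChain m s n x y)
    (hG : G.IsRigid) (h4 : ∀ v, G.degree v = 4)
    (hcard : 2 * (m + 1) + s.toNat + n.toNat ≤ Nat.card G.Vertex) :
    G.numVertices = 2 * (m + 1) + s.toNat + n.toNat ∧
    ∃ e : ChainDart (m + 1) s n ≃ D, (∀ d, e d = G.chainHom m s n x y d) ∧
      (∀ d, e d.rot = G.σ (e d)) ∧ ∀ d, e d.flip = G.α (e d) := by
  have h1 := natCard_darts h4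
  have h2 : Nat.card (ChainDart (m + 1) s n) = _ := natCard_chainDart (Nat.succ_pos m)
  have : Finite (ChainDart (m + 1) s n) :=
    Finite.of_injective _ (chainDartEmb_bijective (Nat.succ_pos m)).1
  have : Nonempty (ChainDart (m + 1) s n) := ⟨.inner 0 true 0⟩
  have hb := bijective_of_hom (N := chainMap (m + 1) s n) hG.connected (G.chainHom m s n x y)
    (h.chainHom_rot hG.toIsTame) (h.chainHom_flip hG.toIsTame) (by omega)
  have h3 := Nat.card_congr (Equiv.ofBijective _ hb)
  refine ⟨?_, Equiv.ofBijective _ hb, fun _ => rfl, h.chainHom_rot hG.toIsTame,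
    h.chainHom_flip hG.toIsTame⟩
  rw [numVertices]
  omega

theorem IsInflation.exists_equiv [Finite D] {m : ℕ} {x y : D} (h : G.IsInflation m x y)
    (hG : G.IsRigid) (h4 : ∀ v, G.degree v = 4)
    (hcard : 2 * (m + 1) ≤ Nat.card G.Vertex) :
    G.numVertices = 2 * (m + 1) ∧
    ∃ e : Fin (m + 1) × Bool × Fin 4 ≃ D,
      (∀ d, e ((inflationMap (m + 1)).σ d) = G.σ (e d)) ∧
      ∀ d, e (inflationFlip (m + 1) d) = G.α (e d) := by
  have h1 := natCard_darts h4
  have h2 : Nat.card (Fin (m + 1) × Bool × Fin 4) = 8 * (m + 1) := by simp; ring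
  have hb := bijective_of_hom (N := inflationMap (m + 1)) hG.connected (G.inflationHom m x y)
    (inflationHom_σ hG.toIsTame) (inflationHom_α hG.toIsTame h.circle h.top h.bot) (by omega)
  have h3 := Nat.card_congr (Equiv.ofBijective _ hb)
  refine ⟨?_, Equiv.ofBijective _ hb, inflationHom_σ hG.toIsTame,
    inflationHom_α hG.toIsTame h.circle h.top h.bot⟩
  rw [numVertices]
  omega

theorem iso_of_equiv {E : Type*} {N : CombMap E} (e : E ≃ D) (hσ : ∀ d, e (N.σ d) = G.σ (e d))
    (hα : ∀ d, e (N.α d) = G.α (e d)) : G.Iso N := by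
  refine ⟨e.symm, fun d => ?_, fun d => ?_⟩
  · rw [Equiv.symm_apply_eq, hσ, Equiv.apply_symm_apply]
  · rw [Equiv.symm_apply_eq, hα, Equiv.apply_symm_apply]

/-! ### The 2-gons of a chain and their neighbours. -/

theorem IsTame.size_eq_two_iff (hG : G.IsTame) (d : D) :
    G.size (G.faceOf d) = 2 ↔ G.φ (G.φ d) = d := by
  rw [size_faceOf]
  constructor
  · intro h
    have := Function.iterate_minimalPeriod (f := G.φ) (x := d)
    rwa [h] at this
  · intro h
    exact Function.minimalPeriod_eq_prime (p := 2) h (hG.face_ne d)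

theorem IsTame.size_eq_three (hG : G.IsTame) {d : D} (h : G.φ (G.φ (G.φ d)) = d) :
    G.size (G.faceOf d) = 3 := by
  rw [size_faceOf]
  exact Function.minimalPeriod_eq_prime (p := 3) h (hG.face_ne d)

theorem faceOf_eq_iff_of_two {d d' : D} (h : G.φ (G.φ d) = d) :
    G.faceOf d = G.faceOf d' ↔ d' = d ∨ d' = G.φ d := by
  rw [faceOf_eq_iff]
  constructor
  · rintro ⟨i, rfl⟩
    have h2 : ∀ k : ℤ, (G.φ ^ (2 * k)) d = d := fun k => by
      rw [zpow_mul]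
      exact Equiv.Perm.zpow_apply_eq_self_of_apply_eq_self (by rw [zpow_two]; exact h) k
    obtain ⟨k, rfl | rfl⟩ := Int.even_or_odd' i
    · exact Or.inl (h2 k)
    · right
      rw [add_comm, zpow_add, Equiv.Perm.mul_apply, h2, zpow_one]
  · rintro (rfl | rfl)
    · exact Equiv.Perm.SameCycle.refl _ _
    · exact Equiv.Perm.sameCycle_apply_right.2 (Equiv.Perm.SameCycle.refl _ _)

theorem faceOf_eq_iff_of_three {d d' : D} (h : G.φ (G.φ (G.φ d)) = d) :
    G.faceOf d = G.faceOf d' ↔ d' = d ∨ d' = G.φ d ∨ d' = G.φ (G.φ d) := by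
  rw [faceOf_eq_iff]
  constructor
  · rintro ⟨i, rfl⟩
    have h2 : ∀ k : ℤ, (G.φ ^ (3 * k)) d = d := fun k => by
      rw [zpow_mul]
      exact Equiv.Perm.zpow_apply_eq_self_of_apply_eq_self h k
    obtain ⟨k, hk⟩ : ∃ k, i = 3 * k ∨ i = 1 + 3 * k ∨ i = 2 + 3 * k := ⟨i / 3, by omega⟩
    rcases hk with rfl | rfl | rfl
    · exact Or.inl (h2 k)
    · right; left
      rw [zpow_add, Equiv.Perm.mul_apply, h2, zpow_one]
    · right; right
      rw [zpow_add, Equiv.Perm.mul_apply, h2, zpow_two]; rfl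
  · rintro (rfl | rfl | rfl)
    · exact Equiv.Perm.SameCycle.refl _ _
    · exact Equiv.Perm.sameCycle_apply_right.2 (Equiv.Perm.SameCycle.refl _ _)
    · exact Equiv.Perm.sameCycle_apply_right.2
        (Equiv.Perm.sameCycle_apply_right.2 (Equiv.Perm.SameCycle.refl _ _))

theorem IsDigon.two {x y : D} (h : G.IsDigon x y) : G.φ (G.φ (G.σ x)) = G.σ x := by
  have ha := G.α_α
  simp only [φ_apply]
  rw [← h.2, ha, ← h.1, ha, h.2]

theorem IsPole.two {x y : D} (h : G.IsPole x y) (hG : G.IsTame) :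
    G.φ (G.φ (G.σ x)) = G.σ x := by
  have h4 := hG.σ_four
  have ha := G.α_α
  obtain ⟨h1, h2, h3⟩ := h
  simp only [φ_apply]
  rw [← h2, h3, h4, ha]

theorem IsPole.symm {x y : D} (h : G.IsPole x y) (hG : G.IsTame) : G.IsPole y x :=
  ⟨h.2.1, h.1, by rw [h.2.2, hG.σ_four]⟩

/-- Each of the two 2-gons has the pole and one vertex of the pair as its vertices; `hxy` keeps the
latter two apart. -/
theorem IsPole.shareVertex {x y : D} (h : G.IsPole x y) (hG : G.IsTame)
    (hxy : G.vertexOf x ≠ G.vertexOf y) :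
    G.ShareVertex (G.faceOf (G.σ x)) (G.faceOf (G.σ y)) := by
  have h4 := hG.σ_four
  have hv := G.vertexOf_σ
  have key : ∀ x y, G.IsPole x y → ∀ v, G.OnFace v (G.faceOf (G.σ x)) ↔
      v = G.vertexOf x ∨ v = G.vertexOf (G.α x) := by
    intro x y h v
    have hφ : G.φ (G.σ x) = G.α x := by rw [φ_apply, ← h.2.1, h.2.2, h4]
    constructor
    · rintro ⟨d, rfl, hd⟩
      rcases (faceOf_eq_iff_of_two (h.two hG)).1 hd.symm with rfl | rfl
      · exact Or.inl (hv x)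
      · exact Or.inr (by rw [hφ])
    · rintro (rfl | rfl)
      · exact ⟨G.σ x, hv x, rfl⟩
      · exact ⟨_, rfl, by rw [← hφ, faceOf_φ]⟩
  have hP : G.vertexOf (G.α y) = G.vertexOf (G.α x) := by rw [h.2.2, hv, hv]
  refine ⟨G.vertexOf (G.α x), ⟨(key x y h _).2 (Or.inr rfl), (key y x (h.symm hG) _).2
    (Or.inr hP.symm)⟩, ?_⟩
  rintro v ⟨h1, h2⟩
  rcases (key x y h _).1 h1 with rfl | rfl
  · rcases (key y x (h.symm hG) _).1 h2 with h' | h'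
    · exact (hxy h').elim
    · exact h'.trans hP
  · rfl

/-- A `2`-gon at the end of a chain with at least two levels is adjacent to two triangles. -/
theorem IsDigon.adjTwoTriangles {x y : D} (h : G.IsDigon (G.straight x) (G.straight y))
    (hl : G.IsLink x y) (hG : G.IsRigid) (hxy : x ≠ y) :
    G.AdjTwoTriangles (G.faceOf (G.σ (G.straight x))) := by
  have h4 := hG.σ_four
  have ha := G.α_α
  have tri : ∀ x y, G.α (G.straight x) = G.σ (G.straight y) → G.σ (G.α x) = G.α (G.σ y) →
      G.φ (G.straight x) = G.α y ∧ G.φ (G.α y) = G.σ y ∧ G.φ (G.σ y) = G.straight x := by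
    intro x y h1 h2
    refine ⟨?_, ?_, ?_⟩
    · rw [φ_apply, h1, straight, h4]
    · rw [φ_apply, ha]
    · rw [φ_apply, ← h2, straight]
  obtain ⟨t1, t2, t3⟩ := tri x y h.1 hl.1
  obtain ⟨u1, u2, u3⟩ := tri y x h.2 hl.2
  have tx : G.φ (G.φ (G.φ (G.straight x))) = G.straight x := by rw [t1, t2, t3]
  have ty : G.φ (G.φ (G.φ (G.straight y))) = G.straight y := by rw [u1, u2, u3]
  refine ⟨G.faceOf (G.straight x), G.faceOf (G.straight y), fun hc => ?_,
    hG.toIsTame.size_eq_three tx, hG.toIsTame.size_eq_three ty, ⟨G.σ (G.straight y), ?_, ?_⟩,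
    ⟨G.σ (G.straight x), rfl, ?_⟩⟩
  · rcases (faceOf_eq_iff_of_three tx).1 hc with hc | hc | hc
    · exact hxy (G.α.injective (G.σ.injective (G.σ.injective hc))).symm
    · rw [t1, straight] at hc
      exact hG.σ_σ_ne _ hc
    · rw [t1, t2] at hc
      refine hG.no_loop y ?_
      rw [← vertexOf_σ y, ← hc, straight, vertexOf_σ, vertexOf_σ]
  · rw [← h.1, ← faceOf_φ, φ_apply, ha]
  · rw [← h.1, ha]
  · rw [← h.2, ha]

end CombMap

namespace ChainDart

variable {m : ℕ} {s n : Bool}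

theorem rot_inner (k : Fin m) (b : Bool) :
    (inner k b 0 : ChainDart m s n).rot = inner k b 1 ∧
    (inner k b 1 : ChainDart m s n).rot = inner k b 2 ∧
    (inner k b 2 : ChainDart m s n).rot = inner k b 3 ∧
    (inner k b 3 : ChainDart m s n).rot = inner k b 0 := ⟨rfl, rfl, rfl, rfl⟩

theorem rot_south (hs : s = true) (hm : 0 < m) (b : Bool) :
    (south hs hm b true : ChainDart m s n).rot = south hs hm b false ∧
    (south hs hm b false : ChainDart m s n).rot = south hs hm (!b) true := ⟨rfl, rfl⟩

theorem rot_north (hn : n = true) (hm : 0 < m) (b : Bool) :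
    (north hn hm b false : ChainDart m s n).rot = north hn hm b true ∧
    (north hn hm b true : ChainDart m s n).rot = north hn hm (!b) false := ⟨rfl, rfl⟩

/-- The `2`-gons of `chainMap (m + 1) s n` are at its ends. -/
theorem eq_of_two {m : ℕ} {s n : Bool} (hm : 1 ≤ m) (d : ChainDart (m + 1) s n)
    (hd : d.flip.rot.flip.rot = d) : ∃ b, d = .inner (Fin.last m) b 1 ∨
      d = (ChainDart.inner (Fin.last m) b 1 : ChainDart (m + 1) s n).flip.rot ∨
      d = .inner 0 b 3 ∨ d = (ChainDart.inner 0 b 3 : ChainDart (m + 1) s n).flip.rot := by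
  have hm0 : 0 < m := hm
  rcases d with ⟨⟨k, hk⟩, b, j⟩ | ⟨hs, h0, b, r⟩ | ⟨hn, h0, b, r⟩
  · refine ⟨b, ?_⟩
    fin_cases j <;> simp only [Fin.zero_eta, Fin.mk_one, Fin.reduceFinMk] at hd ⊢
    · exfalso
      by_cases h1 : k < m
      · simp [flip, rot_inner, h1] at hd
      · obtain rfl : k = m := by omega
        cases n <;> simp [flip, rot_inner, rot_north, hm0] at hd
    · by_cases h1 : k < m
      · exfalso
        by_cases h2 : k + 1 < m <;> cases n <;> simp [flip, rot_inner, rot_north, h1, h2] at hd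
      · obtain rfl : k = m := by omega
        exact Or.inl rfl
    · exfalso
      rcases k with _ | k
      · cases s <;> simp [flip, rot_inner, rot_south, hm0] at hd
      · have h1 : k < m := by omega
        simp [flip, rot_inner, h1] at hd
    · rcases k with _ | k
      · exact Or.inr (Or.inr (Or.inl rfl))
      · exfalso
        rcases k with _ | k <;> cases s <;> simp [flip, rot_inner, rot_south] at hd
  · refine ⟨b, ?_⟩
    cases r
    · right; right; right
      simp [flip, rot, hs]
    · exfalso
      simp [flip, rot_inner, hm0] at hd
  · refine ⟨b, ?_⟩
    cases r
    · exfalso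
      simp [flip, rot_inner, hm0] at hd
    · right; left
      simp [flip, rot, hn, Fin.last]

end ChainDart

/-! ### From connectivity to separating pairs. -/

namespace CombMap

variable {D : Type*} {G : CombMap D}

theorem exists_separation_of_not_preconnected {S : Set G.Vertex}
    (h : ¬ (G.graph.induce Sᶜ).Preconnected) :
    ∃ A B : Set G.Vertex, A.Nonempty ∧ B.Nonempty ∧ Disjoint A B ∧ A ∪ B = Sᶜ ∧
      ∀ d, G.vertexOf d ∈ A → G.vertexOf (G.α d) ∉ B := by
  simp only [SimpleGraph.Preconnected] at h
  push Not at h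
  obtain ⟨x, y, hxy⟩ := h
  let A : Set G.Vertex := {w | ∃ hw : w ∈ Sᶜ, (G.graph.induce Sᶜ).Reachable x ⟨w, hw⟩}
  have hA : A ⊆ Sᶜ := fun w hw => hw.1
  refine ⟨A, Sᶜ \ A, ⟨x, x.2, .refl _⟩, ⟨y, y.2, fun hy => hxy hy.2⟩, Set.disjoint_sdiff_right,
    Set.union_sdiff_cancel hA, ?_⟩
  rintro d hd ⟨hd1, hd2⟩
  obtain ⟨hd0, hr⟩ := id hd
  refine hd2 ⟨hd1, hr.trans (SimpleGraph.Adj.reachable ?_)⟩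
  exact ⟨fun heq => hd2 ((show G.vertexOf d = G.vertexOf (G.α d) from heq) ▸ hd), d, rfl, rfl⟩

/-- A disconnecting empty set contradicts connectedness, and a disconnecting singleton is a cut
vertex. -/
theorem IsRigid.isVertexConnected_two (hG : G.IsRigid) : G.IsVertexConnected 2 := by
  intro S hS
  by_contra hcon
  obtain ⟨A, B, hA, ⟨b, hb⟩, hd, hAB, hedge⟩ := exists_separation_of_not_preconnected hcon
  have hdj := Set.disjoint_left.1 hd
  have hsub : ∀ w, w ∉ S → w ∈ A ∨ w ∈ B := fun w hw => by
    have : w ∈ A ∪ B := hAB ▸ hw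
    exact this
  have hbS : b ∉ S := (hAB ▸ Or.inr hb : b ∈ ((S : Set G.Vertex))ᶜ)
  rcases S.eq_empty_or_nonempty with rfl | ⟨v, hv⟩
  · obtain ⟨d, rfl, hdA⟩ := exists_dart_of_exits hG.connected hA (fun hc => hdj hc hb)
      (fun d hd => Or.inl ((hsub (G.vertexOf (G.α d)) (by simp)).resolve_right (hedge d hd)))
    exact hedge _ hdA (by rwa [G.α_α])
  · have hSv : ∀ w ∈ S, w = v := fun w hw => by
      have := Finset.card_le_one.1 (by omega : S.card ≤ 1)
      exact this w hw v hv
    have hvA : v ∉ A := fun hc => (hAB ▸ Or.inl hc : v ∈ ((S : Set G.Vertex))ᶜ) hv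
    refine hdj (hG.noCutVertex v A hA hvA (fun d hd => ?_) b fun hbv => hbS (hbv ▸ hv)) hb
    by_cases hdS : G.vertexOf (G.α d) ∈ S
    · exact Or.inr (hSv _ hdS)
    · exact Or.inl ((hsub _ hdS).resolve_right (hedge d hd))

theorem IsRigid.exists_separates (hG : G.IsRigid) (h : ¬ G.IsVertexConnected 3) :
    ∃ x y A B, G.Separates x y A B ∧ A.Nonempty ∧ B.Nonempty := by
  simp only [IsVertexConnected] at h
  push Not at h
  obtain ⟨S, hS, hcon⟩ := h
  have hS2 : S.card = 2 := by
    by_contra hne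
    exact hcon (hG.isVertexConnected_two S (by omega))
  classical
  obtain ⟨u, v, huv, rfl⟩ := Finset.card_eq_two.1 hS2
  obtain ⟨A, B, hA, hB, hd, hAB, hedge⟩ := exists_separation_of_not_preconnected hcon
  obtain ⟨x, rfl⟩ := exists_vertexOf_eq u
  obtain ⟨y, rfl⟩ := exists_vertexOf_eq v
  have key : ∀ w, (w ∈ A ∨ w ∈ B) ↔ ¬ (w = G.vertexOf x ∨ w = G.vertexOf y) := fun w => by
    have : w ∈ A ∪ B ↔ w ∈ ((({G.vertexOf x, G.vertexOf y} : Finset G.Vertex)) : Set G.Vertex)ᶜ :=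
      hAB ▸ Iff.rfl
    simpa using this
  refine ⟨x, y, A, B, ⟨huv, fun w => ?_, hd, ?_, ?_, ?_, ?_, hedge⟩, hA, hB⟩
  · have := key w; tauto
  · have := key (G.vertexOf x); tauto
  · have := key (G.vertexOf x); tauto
  · have := key (G.vertexOf y); tauto
  · have := key (G.vertexOf y); tauto

/-! ### Recognizing the three families of chains. -/

theorem IsLink.rev {x y : D} (h : G.IsLink x y) : G.IsLink (G.α x) (G.α y) := by
  have ha := G.α_α
  exact ⟨by rw [h.2, ha, ha], by rw [h.1, ha, ha]⟩

/-- Turning the chain upside down exchanges its ends. This is needed because the model of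
`I_{5,2m+1}` has its pole in the south. -/
theorem IsChain.rev {m : ℕ} {s n : Bool} {x y : D} (h : G.IsChain m s n x y) (hG : G.IsTame) :
    G.IsChain m n s (G.σ (G.σ (G.straight^[m] x))) (G.σ (G.σ (G.straight^[m] y))) := by
  have h4 := hG.σ_four
  have step : ∀ x, G.straight (G.σ (G.σ (G.straight x))) = G.σ (G.σ x) := fun x => by
    simp only [straight, h4, G.α_α]
  have iter : ∀ x k, k ≤ m → G.straight^[k] (G.σ (G.σ (G.straight^[m] x))) =
      G.σ (G.σ (G.straight^[m - k] x)) := by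
    intro x k hk
    induction k with
    | zero => rfl
    | succ k ih =>
      rw [Function.iterate_succ_apply', ih (by omega), show m - k = (m - (k + 1)) + 1 by omega,
        Function.iterate_succ_apply', step]
  refine ⟨fun k hk => ?_, ?_, ?_⟩
  · rw [iter x k hk.le, iter y k hk.le, show m - k = (m - (k + 1)) + 1 by omega,
      Function.iterate_succ_apply', Function.iterate_succ_apply']
    simp only [straight, h4]
    exact (h.link _ (by omega)).rev
  · rw [iter x m le_rfl, iter y m le_rfl, Nat.sub_self]
    exact h.bot
  · rw [h4, h4]
    exact h.top

theorem IsDigon.faceOf_eq {x y : D} (h : G.IsDigon x y) :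
    G.faceOf (G.σ x) = G.faceOf (G.σ y) := by
  rw [← faceOf_φ, φ_apply, ← h.2, G.α_α]

theorem p_two_eq_ncard : G.p 2 = Set.ncard {f | G.size f = 2} := rfl

/-- The data of an identification of `G` with a chain. -/
structure ChainEquiv (G : CombMap D) (m : ℕ) (s n : Bool) (x y : D) where
  chain : G.IsChain m s n x y
  e : ChainDart (m + 1) s n ≃ D
  e_apply : ∀ d, e d = G.chainHom m s n x y d
  e_rot : ∀ d, e d.rot = G.σ (e d)
  e_flip : ∀ d, e d.flip = G.α (e d)

namespace ChainEquiv

variable {m : ℕ} {s n : Bool} {x y : D}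

/-- The `2`-gons at the upper end. -/
def topFace (_ : G.ChainEquiv m s n x y) (b : Bool) : G.Face :=
  G.faceOf (G.σ (G.chainBase x y m b))

/-- The `2`-gons at the lower end. -/
def botFace (_ : G.ChainEquiv m s n x y) (b : Bool) : G.Face :=
  G.faceOf (G.σ (G.σ (G.σ (G.chainBase x y 0 b))))

theorem iso (c : G.ChainEquiv m s n x y) : G.Iso (chainMap (m + 1) s n) :=
  iso_of_equiv c.e c.e_rot c.e_flip

theorem e_φ (c : G.ChainEquiv m s n x y) (d : ChainDart (m + 1) s n) :
    G.φ (c.e d) = c.e d.flip.rot := by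
  rw [c.e_rot, c.e_flip, φ_apply]

theorem e_top (c : G.ChainEquiv m s n x y) (b : Bool) :
    c.e (.inner (Fin.last m) b 1) = G.σ (G.chainBase x y m b) := c.e_apply _

theorem e_bot (c : G.ChainEquiv m s n x y) (b : Bool) :
    c.e (.inner 0 b 3) = G.σ (G.σ (G.σ (G.chainBase x y 0 b))) := c.e_apply _

theorem vertexOf_ne (c : G.ChainEquiv m s n x y) (hG : G.IsTame) (k : Fin (m + 1)) :
    G.vertexOf (G.chainBase x y k true) ≠ G.vertexOf (G.chainBase x y k false) := by
  have h : ∀ b, c.e (.inner k b 0) = G.chainBase x y k b := fun b => c.e_apply _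
  intro hc
  have := hG.eq_of_vertexOf _ _ hc
  rw [← h, ← h, ← c.e_rot, ← c.e_rot, ← c.e_rot] at this
  simp [ChainDart.rot_inner] at this

theorem two_top (c : G.ChainEquiv m s n x y) (hG : G.IsTame) (b : Bool) :
    G.φ (G.φ (G.σ (G.chainBase x y m b))) = G.σ (G.chainBase x y m b) := by
  cases n
  · have := c.chain.top.2 rfl
    cases b
    · exact IsDigon.two this.symm
    · exact this.two
  · have := c.chain.top.1 rfl
    cases b
    · exact (this.symm hG).two hG
    · exact this.two hG

theorem two_bot (c : G.ChainEquiv m s n x y) (hG : G.IsTame) (b : Bool) :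
    G.φ (G.φ (G.σ (G.σ (G.σ (G.chainBase x y 0 b))))) =
      G.σ (G.σ (G.σ (G.chainBase x y 0 b))) := by
  cases s
  · have := c.chain.bot.2 rfl
    cases b
    · exact IsDigon.two this.symm
    · exact this.two
  · have := c.chain.bot.1 rfl
    cases b
    · exact (this.symm hG).two hG
    · exact this.two hG

theorem size_eq_two_iff (c : G.ChainEquiv m s n x y) (hG : G.IsTame) (hm : 1 ≤ m) (f : G.Face) :
    G.size f = 2 ↔ f = c.topFace true ∨ f = c.topFace false ∨ f = c.botFace true ∨
      f = c.botFace false := by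
  constructor
  · obtain ⟨d, rfl⟩ := exists_faceOf_eq f
    intro hd
    rw [hG.size_eq_two_iff] at hd
    obtain ⟨d, rfl⟩ := c.e.surjective d
    rw [c.e_φ, c.e_φ, c.e.apply_eq_iff_eq] at hd
    obtain ⟨b, rfl | rfl | rfl | rfl⟩ := ChainDart.eq_of_two hm d hd
    · rw [c.e_top]
      cases b <;> simp [topFace]
    · rw [← c.e_φ, c.e_top, faceOf_φ]
      cases b <;> simp [topFace]
    · rw [c.e_bot]
      cases b <;> simp [botFace]
    · rw [← c.e_φ, c.e_bot, faceOf_φ]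
      cases b <;> simp [botFace]
  · rintro (rfl | rfl | rfl | rfl)
    · exact (hG.size_eq_two_iff _).2 (c.two_top hG _)
    · exact (hG.size_eq_two_iff _).2 (c.two_top hG _)
    · exact (hG.size_eq_two_iff _).2 (c.two_bot hG _)
    · exact (hG.size_eq_two_iff _).2 (c.two_bot hG _)

theorem topFace_ne_botFace (c : G.ChainEquiv m s n x y) (hG : G.IsTame) (b b' : Bool) :
    c.topFace b ≠ c.botFace b' := by
  intro h
  have := (faceOf_eq_iff_of_two (c.two_top hG b)).1 h
  rw [← c.e_top, ← c.e_bot, c.e_φ, c.e.apply_eq_iff_eq, c.e.apply_eq_iff_eq] at this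
  cases n <;> simp [ChainDart.flip, ChainDart.rot_inner, ChainDart.rot_north] at this

theorem topFace_ne (c : G.ChainEquiv m s true x y) (hG : G.IsTame) :
    c.topFace true ≠ c.topFace false := by
  intro h
  have := (faceOf_eq_iff_of_two (c.two_top hG true)).1 h
  rw [← c.e_top, ← c.e_top, c.e_φ, c.e.apply_eq_iff_eq, c.e.apply_eq_iff_eq] at this
  simp [ChainDart.flip, ChainDart.rot_north] at this

theorem botFace_ne (c : G.ChainEquiv m true n x y) (hG : G.IsTame) :
    c.botFace true ≠ c.botFace false := by
  intro h
  have := (faceOf_eq_iff_of_two (c.two_bot hG true)).1 h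
  rw [← c.e_bot, ← c.e_bot, c.e_φ, c.e.apply_eq_iff_eq, c.e.apply_eq_iff_eq] at this
  simp [ChainDart.flip, ChainDart.rot_south] at this

theorem topFace_eq (c : G.ChainEquiv m s false x y) : c.topFace true = c.topFace false :=
  (c.chain.top.2 rfl).faceOf_eq

theorem botFace_eq (c : G.ChainEquiv m false n x y) : c.botFace true = c.botFace false :=
  (c.chain.bot.2 rfl).faceOf_eq

theorem topFace_adj (c : G.ChainEquiv (m + 1) s false x y) (hG : G.IsRigid) :
    G.AdjTwoTriangles (c.topFace true) := by
  have h := c.chain.top.2 rfl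
  have hl := c.chain.link m (Nat.lt_succ_self m)
  rw [Function.iterate_succ_apply', Function.iterate_succ_apply'] at h
  rw [topFace, chainBase, Function.iterate_succ_apply']
  exact h.adjTwoTriangles hl hG fun hc => c.vertexOf_ne hG.toIsTame ⟨m, by omega⟩ (congrArg _ hc)

theorem botFace_adj (c : G.ChainEquiv (m + 1) false n x y) (hG : G.IsRigid) :
    G.AdjTwoTriangles (c.botFace true) := by
  have h := c.chain.bot.2 rfl
  have hl := (c.chain.link 0 (Nat.succ_pos m)).rev
  have h' : ∀ z, G.straight (G.α z) = G.σ (G.σ z) := fun z => by rw [straight, G.α_α]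
  rw [← h', ← h'] at h
  have := h.adjTwoTriangles hl hG fun hc =>
    c.vertexOf_ne hG.toIsTame 0 (congrArg _ (G.α.injective hc))
  rwa [h'] at this

theorem topFace_share (c : G.ChainEquiv m s true x y) (hG : G.IsRigid) :
    G.ShareVertex (c.topFace true) (c.topFace false) :=
  (c.chain.top.1 rfl).shareVertex hG.toIsTame (c.vertexOf_ne hG.toIsTame (Fin.last m))

theorem botFace_share (c : G.ChainEquiv m true n x y) (hG : G.IsRigid) :
    G.ShareVertex (c.botFace true) (c.botFace false) :=
  (c.chain.bot.1 rfl).shareVertex hG.toIsTame (by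
    rw [vertexOf_σ, vertexOf_σ, vertexOf_σ, vertexOf_σ]
    exact c.vertexOf_ne hG.toIsTame 0)

/-- An end without a pole carries one 2-gon, named twice by `topFace` or `botFace`, and a pole
carries two. The total determines `i`; the same holds for the other two families. -/
theorem isI6 [Finite D] {i : ℕ} (c : G.ChainEquiv (m + 1) false false x y) (hG : G.IsHedrite i)
    (hV : G.numVertices = 2 * (m + 2)) : G.IsI6 (m + 2) := by
  have hr := hG.isRigid
  have hs := c.size_eq_two_iff hr.toIsTame (by omega)
  have h2 := hG.p_two
  rw [p_two_eq_ncard, show {f | G.size f = 2} = {c.topFace true, c.botFace true} by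
    ext f; simp [hs, c.topFace_eq, c.botFace_eq], Set.ncard_pair
    (c.topFace_ne_botFace hr.toIsTame _ _)] at h2
  obtain rfl : i = 6 := by omega
  refine ⟨hG, hV, fun f hf => ?_, c.iso⟩
  rcases (hs f).1 hf with rfl | rfl | rfl | rfl
  · exact c.topFace_adj hr
  · exact c.topFace_eq ▸ c.topFace_adj hr
  · exact c.botFace_adj hr
  · exact c.botFace_eq ▸ c.botFace_adj hr

theorem isI5 [Finite D] {i : ℕ} (c : G.ChainEquiv (m + 1) true false x y) (hG : G.IsHedrite i)
    (hV : G.numVertices = 2 * (m + 2) + 1) : G.IsI5 (m + 2) := by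
  have hr := hG.isRigid
  have hs : ∀ f, G.size f = 2 ↔ f = c.botFace true ∨ f = c.botFace false ∨ f = c.topFace true := by
    intro f
    rw [c.size_eq_two_iff hr.toIsTame (by omega), ← c.topFace_eq]
    tauto
  have h2 := hG.p_two
  rw [p_two_eq_ncard, show {f | G.size f = 2} = {c.botFace true, c.botFace false, c.topFace true}
    by ext f; simp [hs], Set.ncard_eq_three.2 ⟨_, _, _, c.botFace_ne hr.toIsTame,
    (c.topFace_ne_botFace hr.toIsTame _ _).symm, (c.topFace_ne_botFace hr.toIsTame _ _).symm,
    rfl⟩] at h2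
  obtain rfl : i = 5 := by omega
  exact ⟨hG, hV, ⟨_, _, _, hs, c.botFace_share hr, c.topFace_adj hr⟩, c.iso⟩

theorem isI4 [Finite D] {i : ℕ} (c : G.ChainEquiv (m + 1) true true x y) (hG : G.IsHedrite i)
    (hV : G.numVertices = 2 * (m + 2) + 2) : G.IsI4 (m + 2) := by
  have hr := hG.isRigid
  have hs := c.size_eq_two_iff hr.toIsTame (by omega)
  have h2 := hG.p_two
  have n1 := c.topFace_ne hr.toIsTame
  have n2 := c.botFace_ne hr.toIsTame
  have n3 := c.topFace_ne_botFace hr.toIsTame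
  rw [p_two_eq_ncard, show {f | G.size f = 2} = {c.topFace true, c.topFace false, c.botFace true,
    c.botFace false} by ext f; simp [hs], Set.ncard_insert_of_notMem (by simp [n1, n3]),
    Set.ncard_insert_of_notMem (by simp [n3]), Set.ncard_pair n2] at h2
  obtain rfl : i = 4 := by omega
  exact ⟨hG, hV, ⟨_, _, _, _, hs, c.topFace_share hr, c.botFace_share hr⟩, c.iso⟩

end ChainEquiv

/-! ### Recognizing the nested circles. -/

theorem inflationMap_two {m : ℕ} (hm : 1 ≤ m) (d : Fin (m + 1) × Bool × Fin 4) :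
    (inflationMap (m + 1)).φ ((inflationMap (m + 1)).φ d) = d ↔
      ∃ b, d = (Fin.last m, b, 0) ∨ d = (Fin.last m, !b, 1) ∨ d = (0, b, 2) ∨ d = (0, !b, 3) := by
  have hφ : ∀ d, (inflationMap (m + 1)).φ d = ((inflationFlip (m + 1) d).1,
    (inflationFlip (m + 1) d).2.1, (inflationFlip (m + 1) d).2.2 + 1) := fun d => rfl
  obtain ⟨⟨k, hk⟩, b, j⟩ := d
  rw [hφ, hφ]
  have h3 : (3 : Fin 4) + 1 = 0 := rfl
  have h2 : (2 : Fin 4) + 1 = 3 := rfl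
  have h1 : (1 : Fin 4) + 1 = 2 := rfl
  fin_cases j
  · by_cases h : k < m
    · simp [inflationFlip, h, h2, h1, Fin.ext_iff, h.ne]
    · obtain rfl : k = m := by omega
      simp [inflationFlip, h3, Fin.ext_iff]
  · by_cases h : k < m
    · simp [inflationFlip, h, h3, h2, Fin.ext_iff, h.ne]
    · obtain rfl : k = m := by omega
      simp [inflationFlip, h3, Fin.ext_iff]
  · by_cases h : 0 < k
    · simp [inflationFlip, h, h3, Fin.ext_iff, h.ne']
    · obtain rfl : k = 0 := by omega
      simp [inflationFlip, h2, Fin.ext_iff]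
  · by_cases h : 0 < k
    · simp [inflationFlip, h, h1, Fin.ext_iff, h.ne']
    · obtain rfl : k = 0 := by omega
      simp [inflationFlip, h1, h2, Fin.ext_iff]

theorem isJ4_of_equiv [Finite D] {i m : ℕ} (hG : G.IsHedrite i) (hm : 1 ≤ m)
    (e : Fin (m + 1) × Bool × Fin 4 ≃ D)
    (hσ : ∀ d, e ((inflationMap (m + 1)).σ d) = G.σ (e d))
    (hα : ∀ d, e (inflationFlip (m + 1) d) = G.α (e d))
    (hV : G.numVertices = 2 * (m + 1)) : G.IsJ4 (m + 1) := by
  have ht := hG.isRigid.toIsTame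
  have e_φ : ∀ d, G.φ (e d) = e ((inflationMap (m + 1)).φ d) := fun d => by
    rw [φ_apply, φ_apply, hσ]
    exact congrArg _ (hα d).symm
  have two : ∀ d, G.size (G.faceOf (e d)) = 2 ↔
      ∃ b, d = (Fin.last m, b, 0) ∨ d = (Fin.last m, !b, 1) ∨ d = (0, b, 2) ∨ d = (0, !b, 3) :=
    fun d => by
      rw [ht.size_eq_two_iff, e_φ, e_φ, e.apply_eq_iff_eq, inflationMap_two hm]
  have φ_top : ∀ b, G.φ (e (Fin.last m, b, 0)) = e (Fin.last m, !b, 1) := fun b => by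
    rw [e_φ]
    refine congrArg e ?_
    rw [φ_apply]
    change (inflationMap (m + 1)).σ (inflationFlip (m + 1) (Fin.last m, b, 0)) = _
    simp [inflationFlip, inflationMap]
  have φ_bot : ∀ b, G.φ (e (0, b, 2)) = e (0, !b, 3) := fun b => by
    rw [e_φ]
    refine congrArg e ?_
    rw [φ_apply]
    change (inflationMap (m + 1)).σ (inflationFlip (m + 1) (0, b, 2)) = _
    simp [inflationFlip, inflationMap]
  have top : ∀ b d, G.faceOf (e (Fin.last m, b, 0)) = G.faceOf (e d) ↔
      d = (Fin.last m, b, 0) ∨ d = (Fin.last m, !b, 1) := fun b d => by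
    rw [faceOf_eq_iff_of_two ((ht.size_eq_two_iff _).1 ((two _).2 ⟨b, Or.inl rfl⟩)), φ_top,
      e.apply_eq_iff_eq, e.apply_eq_iff_eq]
  have bot : ∀ b d, G.faceOf (e (0, b, 2)) = G.faceOf (e d) ↔ d = (0, b, 2) ∨ d = (0, !b, 3) :=
    fun b d => by
      rw [faceOf_eq_iff_of_two ((ht.size_eq_two_iff _).1
        ((two _).2 ⟨b, Or.inr (Or.inr (Or.inl rfl))⟩)), φ_bot, e.apply_eq_iff_eq,
        e.apply_eq_iff_eq]
  have h2 := hG.p_two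
  have hset : {f | G.size f = 2} = {G.faceOf (e (Fin.last m, true, 0)),
      G.faceOf (e (Fin.last m, false, 0)), G.faceOf (e (0, true, 2)),
      G.faceOf (e (0, false, 2))} := by
    ext f
    obtain ⟨d, rfl⟩ := exists_faceOf_eq f
    obtain ⟨d, rfl⟩ := e.surjective d
    simp only [Set.mem_ofPred_eq, Set.mem_insert_iff, Set.mem_singleton_iff, two,
      eq_comm (a := G.faceOf (e d)), top, bot, Bool.exists_bool, Bool.not_true, Bool.not_false]
    tauto
  rw [p_two_eq_ncard, hset, Set.ncard_insert_of_notMem (by simp [top]),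
    Set.ncard_insert_of_notMem (by simp [top]), Set.ncard_pair (by simp [bot])] at h2
  obtain rfl : i = 4 := by omega
  exact ⟨hG, hV, iso_of_equiv e hσ hα⟩

end CombMap

/-! ### The main theorem. -/

theorem mainTheorem1 {D : Type*} [Finite D] (G : CombMap D) (i : ℕ) (hG : G.IsHedrite i) :
    G.IsVertexConnected 2 ∧
      (¬ G.IsVertexConnected 3 →
        (∃ m : ℕ, 2 ≤ m ∧ (G.IsI6 m ∨ G.IsI5 m ∨ G.IsI4 m ∨ G.IsJ4 m)) ∨
          G.Iso doubledFourCycle) := by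
  have hr := hG.isRigid
  refine ⟨hr.isVertexConnected_two, fun h3 => ?_⟩
  obtain ⟨x, y, A, B, hs, hA, hB⟩ := hr.exists_separates h3
  have hcard := hs.ncard
  have hA' := (Set.ncard_pos).2 hA
  have hB' := (Set.ncard_pos).2 hB
  rcases hs.exists_structure hG.plane hr hA hB with
    ⟨m, x, y, hi, hm, hle⟩ | ⟨m, s, n, x, y, hc, hle⟩
  · obtain ⟨hV, e, hσ, hα⟩ := hi.exists_equiv hr hG.fourValent hle
    exact Or.inl ⟨m + 1, by omega,
      Or.inr (Or.inr (Or.inr (CombMap.isJ4_of_equiv hG hm e hσ hα hV)))⟩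
  · obtain ⟨hV, e, he, hσ, hα⟩ := hc.exists_equiv hr hG.fourValent hle
    have hV' : 4 ≤ G.numVertices := by rw [CombMap.numVertices]; omega
    rcases m with _ | m
    -- A chain with a single pair has two vertices plus its poles. Two separated nonempty parts
    -- require at least four vertices, so both poles are present and the map is the doubled 4-cycle.
    · cases s <;> cases n <;> simp only [Bool.toNat_true, Bool.toNat_false] at hV <;> try omega
      exact Or.inr (CombMap.iso_of_equiv e hσ hα)
    · refine Or.inl ⟨m + 2, by omega, ?_⟩
      cases s <;> cases n
      · exact Or.inl (CombMap.ChainEquiv.isI6 ⟨hc, e, he, hσ, hα⟩ hG hV)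
      · obtain ⟨hV, e, he, hσ, hα⟩ := (hc.rev hr.toIsTame).exists_equiv hr hG.fourValent
          (by simpa using hle)
        exact Or.inr (Or.inl (CombMap.ChainEquiv.isI5 ⟨hc.rev hr.toIsTame, e, he, hσ, hα⟩ hG hV))
      · exact Or.inr (Or.inl (CombMap.ChainEquiv.isI5 ⟨hc, e, he, hσ, hα⟩ hG hV))
      · exact Or.inr (Or.inr (Or.inl (CombMap.ChainEquiv.isI4 ⟨hc, e, he, hσ, hα⟩ hG hV)))
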